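/- Let $M$ be any model of Quine's New Foundations (NF): a structure for the language of set theory satisfying extensionality and comprehension $\forall\vec x\,\exists y\,\forall z\,(z\in y\leftrightarrow\Phi(\vec x,z))$ for every stratifiable formula $\Phi$. Let $\mathbf N$ be the category whose objects are the sets of $M$ and whose morphisms $A\to B$ are the functions from $A$ to $B$ whose graph is a set of $M$. Call a set $A$ of $M$ strongly cantorian if the graph of the singleton map $\iota\restriction A$, $x\mapsto\{x\}$ $(x\in A)$, is a set of $M$. Write $TA=\{\{a\}:a\in A\}$ and $\mathcal P A$ for the power set of $A$. 1. Subsets and power sets of strongly cantorian sets are strongly cantorian. 2. Strongly cantorian sets are closed under finite products: if $A,B$ are strongly cantorian, then so is the set of all ordered pairs $\langle a,b\rangle$ with $a\in A$, $b\in B$; moreover $A$ and $B$ have a product in $\mathbf N$, every product of $A$ and $B$ in $\mathbf N$ is strongly cantorian, $\mathbf N$ has a terminal object, and every terminal object of $\mathbf N$ is strongly cantorian. 3. The full subcategory $\mathbf{SC}\subseteq\mathbf N$ of strongly cantorian sets is an elementary topos: it has finite limits, every functor $A\times-$ has a right adjoint, and it has a subobject classifier. 4. For all sets $A,B$ of $M$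 and every product $TA\times B$ in $\mathbf N$, there is a bijection between the morphisms $f:B\to\mathcal P A$ and the subobjects of $TA\times B$ in $\mathbf N$, under which $f$ corresponds to $\{(\{a\},b): a\in f(b)\}$. If $A$ is strongly cantorian, then so are $TA$ and $\mathcal P A$, and on $\mathbf{SC}$ the set $\mathcal P A$ represents both $\mathsf{Sub}(TA\times-)$ and $\mathsf{Sub}(A\times-)$, a morphism $f:B\to\mathcal P A$ corresponding to $\{(\{a\},b):a\in f(b)\}$ and to $\{(a,b):a\in f(b)\}$ respectively. In particular $\mathcal P A$ is a power object of $A$ in $\mathbf{SC}$. 5. If $M$ satisfies Rosser's Axiom of Counting (for every natural number $n$, the set $\{m : m \text{ a natural number}, 1\le m\le n\}$ has $n$ elements), then $\mathbf{SC}$ has a natural numbers object. -/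

import Mathlib

open CategoryTheory CategoryTheory.Limits

universe u

namespace NF

/-! ### The language of set theory, stratification, models of NF -/

/-- The relation symbols of the language of set theory: one binary symbol, membership. -/
inductive SetRel : ℕ → Type
  | mem : SetRel 2

/-- The first-order language of set theory. -/
def setLang : FirstOrder.Language := ⟨fun _ => Empty, SetRel⟩

/-- The value of a typing of the variables at a term; a term of `setLang` is a variable. -/
def termType {β : Type} (σ : β → ℕ) : setLang.Term β → ℕ
  | .var b => σ b
  | .func f _ => Empty.elim f

/-- `σ` extends to a stratification of the formula `φ` whose free variables are the `Fin n`: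
each bound variable gets one value (chosen at its quantifier), both sides of an equation
have the same value, and in a membership the value goes up by one from left to right. -/
def Stratifies : {n : ℕ} → setLang.BoundedFormula Empty n → (Fin n → ℕ) → Prop
  | _, .falsum, _ => True
  | _, .equal t₁ t₂, σ =>
      termType (Sum.elim Empty.elim σ) t₁ = termType (Sum.elim Empty.elim σ) t₂
  | _, .rel (l := 2) SetRel.mem ts, σ =>
      termType (Sum.elim Empty.elim σ) (ts 0) + 1 = termType (Sum.elim Empty.elim σ) (ts 1)
  | _, .imp φ ψ, σ => Stratifies φ σ ∧ Stratifies ψ σ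
  | _, .all φ, σ => ∃ k : ℕ, Stratifies φ (Fin.snoc (α := fun _ => ℕ) σ k)

/-- A formula is stratifiable if it has a stratification. -/
def Stratifiable {n : ℕ} (φ : setLang.BoundedFormula Empty n) : Prop :=
  ∃ σ : Fin n → ℕ, Stratifies φ σ

/-- Membership in a structure for the language of set theory. -/
def Mem {M : Type u} [setLang.Structure M] (x y : M) : Prop :=
  FirstOrder.Language.Structure.RelMap (L := setLang) SetRel.mem ![x, y]

infix:50 " ∈' " => Mem

/-- `M` is a model of NF: extensionality, and comprehension for every stratifiable formula
`Φ(x₀, …, xₙ₋₁, z)`. -/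
class Model (M : Type u) [setLang.Structure M] : Prop where
  extensionality : ∀ x y : M, (∀ z, z ∈' x ↔ z ∈' y) → x = y
  comprehension : ∀ (n : ℕ) (φ : setLang.BoundedFormula Empty (n + 1)), Stratifiable φ →
    ∀ x : Fin n → M, ∃ y : M, ∀ z : M,
      z ∈' y ↔ φ.Realize (default : Empty → M) (Fin.snoc (α := fun _ => M) x z)

section Sets

variable {M : Type u} [setLang.Structure M]

/-- `A ⊆ B`. -/
def Sub (A B : M) : Prop := ∀ x, x ∈' A → x ∈' B

/-- `s = {x}`. -/
def IsSingleton (s x : M) : Prop := ∀ z, z ∈' s ↔ z = x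

/-- `p = {{x}, {x, y}}`, the ordered pair `⟨x, y⟩`. -/
def IsPair (p x y : M) : Prop :=
  ∀ q, q ∈' p ↔ ((∀ z, z ∈' q ↔ z = x) ∨ (∀ z, z ∈' q ↔ z = x ∨ z = y))

/-- The graph of the relation `R` (a class of pairs) is a set. -/
def GraphIsSet (R : M → M → Prop) : Prop :=
  ∃ g : M, ∀ p, p ∈' g ↔ ∃ x y, R x y ∧ IsPair p x y

/-- `A` is strongly cantorian: the graph of the singleton map `ι` restricted to `A` is a set. -/
def StronglyCantorian (A : M) : Prop :=
  GraphIsSet (fun x s : M => x ∈' A ∧ IsSingleton s x)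

/-! ### Comprehension for semantically presented stratified conditions -/

/-- The condition `R` is defined by a formula that `σ` stratifies. -/
def SDef {n : ℕ} (σ : Fin n → ℕ) (R : (Fin n → M) → Prop) : Prop :=
  ∃ φ : setLang.BoundedFormula Empty n, Stratifies φ σ ∧
    ∀ v : Fin n → M, φ.Realize (default : Empty → M) v ↔ R v

theorem SDef.congr {n : ℕ} {σ : Fin n → ℕ} {R S : (Fin n → M) → Prop} (h : SDef σ R)
    (e : ∀ v, R v ↔ S v) : SDef σ S := by
  obtain ⟨φ, hs, hr⟩ := h
  exact ⟨φ, hs, fun v => (hr v).trans (e v)⟩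

theorem SDef.mem {n : ℕ} {σ : Fin n → ℕ} (i j : Fin n) (h : σ i + 1 = σ j) :
    SDef σ (fun v : Fin n → M => v i ∈' v j) := by
  refine ⟨.rel (l := 2) (SetRel.mem : setLang.Relations 2) ![.var (.inr i), .var (.inr j)],
    ?_, fun v => ?_⟩
  · simpa [Stratifies, termType] using h
  · simp only [FirstOrder.Language.BoundedFormula.Realize, Mem]
    apply iff_of_eq
    congr 1
    funext k
    fin_cases k <;> rfl

theorem SDef.eq {n : ℕ} {σ : Fin n → ℕ} (i j : Fin n) (h : σ i = σ j) :
    SDef σ (fun v : Fin n → M => v i = v j) :=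
  ⟨.equal (.var (.inr i)) (.var (.inr j)), h, fun _ => Iff.rfl⟩

theorem SDef.imp {n : ℕ} {σ : Fin n → ℕ} {R S : (Fin n → M) → Prop} (hR : SDef σ R)
    (hS : SDef σ S) : SDef σ (fun v => R v → S v) := by
  obtain ⟨φ, h1, h2⟩ := hR
  obtain ⟨ψ, h3, h4⟩ := hS
  exact ⟨.imp φ ψ, ⟨h1, h3⟩, fun v => imp_congr (h2 v) (h4 v)⟩

theorem SDef.not {n : ℕ} {σ : Fin n → ℕ} {R : (Fin n → M) → Prop} (hR : SDef σ R) :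
    SDef σ (fun v => ¬ R v) := by
  obtain ⟨φ, h1, h2⟩ := hR
  exact ⟨.imp φ .falsum, ⟨h1, trivial⟩, fun v => not_congr (h2 v)⟩

theorem SDef.or {n : ℕ} {σ : Fin n → ℕ} {R S : (Fin n → M) → Prop} (hR : SDef σ R)
    (hS : SDef σ S) : SDef σ (fun v => R v ∨ S v) :=
  (hR.not.imp hS).congr fun _ => or_iff_not_imp_left.symm

theorem SDef.and {n : ℕ} {σ : Fin n → ℕ} {R S : (Fin n → M) → Prop} (hR : SDef σ R)
    (hS : SDef σ S) : SDef σ (fun v => R v ∧ S v) :=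
  (hR.imp hS.not).not.congr fun v => by tauto

theorem SDef.iff {n : ℕ} {σ : Fin n → ℕ} {R S : (Fin n → M) → Prop} (hR : SDef σ R)
    (hS : SDef σ S) : SDef σ (fun v => R v ↔ S v) :=
  ((hR.imp hS).and (hS.imp hR)).congr fun v => by tauto

/-- The quantified variable is the last one; it gets the value `k`. -/
theorem SDef.all {n : ℕ} {σ : Fin n → ℕ} (k : ℕ) {R : (Fin n → M) → M → Prop}
    (h : SDef (Fin.snoc (α := fun _ => ℕ) σ k)
      (fun w : Fin (n + 1) → M => R (fun i => w i.castSucc) (w (Fin.last n)))) :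
    SDef σ (fun v => ∀ x, R v x) := by
  obtain ⟨φ, h1, h2⟩ := h
  refine ⟨.all φ, ⟨k, h1⟩, fun v => forall_congr' fun x => ?_⟩
  simpa using h2 (Fin.snoc (α := fun _ => M) v x)

/-- The quantified variable is the last one; it gets the value `k`. -/
theorem SDef.ex {n : ℕ} {σ : Fin n → ℕ} (k : ℕ) {R : (Fin n → M) → M → Prop}
    (h : SDef (Fin.snoc (α := fun _ => ℕ) σ k)
      (fun w : Fin (n + 1) → M => R (fun i => w i.castSucc) (w (Fin.last n)))) :
    SDef σ (fun v => ∃ x, R v x) :=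
  (SDef.all (R := fun v x => ¬ R v x) k h.not).not.congr fun v => by simp

theorem SDef.singleton {n : ℕ} {σ : Fin n → ℕ} (s i : Fin n) (h : σ i + 1 = σ s) :
    SDef σ (fun v : Fin n → M => IsSingleton (v s) (v i)) :=
  SDef.all (R := fun v z => z ∈' v s ↔ z = v i) (σ i)
    ((SDef.mem (Fin.last n) s.castSucc (by simpa using h)).iff
      (SDef.eq (Fin.last n) i.castSucc (by simp)))

theorem SDef.pair {n : ℕ} {σ : Fin n → ℕ} (p i j : Fin n) (hij : σ j = σ i)
    (hp : σ i + 2 = σ p) : SDef σ (fun v : Fin n → M => IsPair (v p) (v i) (v j)) := by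
  refine SDef.all (R := fun v q => q ∈' v p ↔
    ((∀ z, z ∈' q ↔ z = v i) ∨ (∀ z, z ∈' q ↔ z = v i ∨ z = v j))) (σ i + 1)
    ((SDef.mem (Fin.last n) p.castSucc (by simpa using hp)).iff (SDef.or ?_ ?_))
  · exact SDef.singleton (Fin.last n) i.castSucc (by simp)
  · exact SDef.all (R := fun w z => z ∈' w (Fin.last n) ↔
        z = w i.castSucc ∨ z = w j.castSucc) (σ i)
      ((SDef.mem (Fin.last _) (Fin.last n).castSucc (by simp)).iff
        ((SDef.eq (Fin.last _) i.castSucc.castSucc (by simp)).or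
          (SDef.eq (Fin.last _) j.castSucc.castSucc (by simp [hij]))))

/-- Stratified comprehension with one parameter. -/
theorem SDef.comprehension₁ [Model M] (σ : Fin 2 → ℕ) {R : M → M → Prop}
    (h : SDef σ (fun v : Fin 2 → M => R (v 0) (v 1))) (a : M) :
    ∃ y : M, ∀ z, z ∈' y ↔ R a z := by
  obtain ⟨φ, hs, hr⟩ := h
  obtain ⟨y, hy⟩ := Model.comprehension 1 φ ⟨σ, hs⟩ (fun _ : Fin 1 => a)
  refine ⟨y, fun z => (hy z).trans ((hr _).trans (iff_of_eq ?_))⟩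
  rfl

/-- Stratified comprehension with two parameters. -/
theorem SDef.comprehension₂ [Model M] (σ : Fin 3 → ℕ) {R : M → M → M → Prop}
    (h : SDef σ (fun v : Fin 3 → M => R (v 0) (v 1) (v 2))) (a b : M) :
    ∃ y : M, ∀ z, z ∈' y ↔ R a b z := by
  obtain ⟨φ, hs, hr⟩ := h
  obtain ⟨y, hy⟩ := Model.comprehension 2 φ ⟨σ, hs⟩ ![a, b]
  refine ⟨y, fun z => (hy z).trans ((hr _).trans (iff_of_eq ?_))⟩
  rfl

/-! ### The sets `ι``A`, `𝒫 A`, `A × B` -/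

theorem exists_singletons [Model M] (A : M) :
    ∃ y : M, ∀ s, s ∈' y ↔ ∃ x, x ∈' A ∧ IsSingleton s x :=
  SDef.comprehension₁ ![1, 1] (R := fun A s => ∃ x, x ∈' A ∧ IsSingleton s x)
    (SDef.ex (R := fun v x => x ∈' v 0 ∧ IsSingleton (v 1) x) 0
      ((SDef.mem (Fin.last 2) 0 rfl).and (SDef.singleton 1 (Fin.last 2) rfl))) A

theorem exists_power [Model M] (A : M) : ∃ y : M, ∀ x, x ∈' y ↔ Sub x A :=
  SDef.comprehension₁ ![1, 1] (R := fun A x => Sub x A)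
    (SDef.all (R := fun v z => z ∈' v 1 → z ∈' v 0) 0
      ((SDef.mem (Fin.last 2) 1 rfl).imp (SDef.mem (Fin.last 2) 0 rfl))) A

theorem exists_prod [Model M] (A B : M) :
    ∃ y : M, ∀ p, p ∈' y ↔ ∃ a b, (a ∈' A ∧ b ∈' B) ∧ IsPair p a b :=
  SDef.comprehension₂ ![1, 1, 2] (R := fun A B p => ∃ a b, (a ∈' A ∧ b ∈' B) ∧ IsPair p a b)
    (SDef.ex (R := fun v a => ∃ b, (a ∈' v 0 ∧ b ∈' v 1) ∧ IsPair (v 2) a b) 0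
      (SDef.ex (R := fun v b => (v 3 ∈' v 0 ∧ b ∈' v 1) ∧ IsPair (v 2) (v 3) b) 0
        (((SDef.mem 3 0 rfl).and (SDef.mem 4 1 rfl)).and (SDef.pair 2 3 4 rfl rfl)))) A B

/-- `ι``A = {{x} | x ∈ A}`. -/
noncomputable def singletons [Model M] (A : M) : M := (exists_singletons A).choose

theorem mem_singletons [Model M] {A s : M} :
    s ∈' singletons A ↔ ∃ x, x ∈' A ∧ IsSingleton s x := (exists_singletons A).choose_spec s

/-- The power set of `A`. -/
noncomputable def power [Model M] (A : M) : M := (exists_power A).choose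

theorem mem_power [Model M] {A x : M} : x ∈' power A ↔ Sub x A := (exists_power A).choose_spec x

/-- The set of the pairs `⟨a, b⟩` with `a ∈ A` and `b ∈ B`. -/
noncomputable def cartesian [Model M] (A B : M) : M := (exists_prod A B).choose

theorem mem_cartesian [Model M] {A B p : M} :
    p ∈' cartesian A B ↔ ∃ a b, (a ∈' A ∧ b ∈' B) ∧ IsPair p a b := (exists_prod A B).choose_spec p

theorem exists_pair [Model M] (a b : M) : ∃ p, IsPair p a b :=
  SDef.comprehension₂ ![0, 0, 1] (R := fun a b q =>
      (∀ z, z ∈' q ↔ z = a) ∨ (∀ z, z ∈' q ↔ z = a ∨ z = b))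
    ((SDef.singleton 2 0 rfl).or
      (SDef.all (R := fun v z => z ∈' v 2 ↔ z = v 0 ∨ z = v 1) 0
        ((SDef.mem 3 2 rfl).iff ((SDef.eq 3 0 rfl).or (SDef.eq 3 1 rfl))))) a b

theorem exists_singleton [Model M] (a : M) : ∃ s, IsSingleton s a :=
  SDef.comprehension₁ ![0, 0] (R := fun a z => z = a) (SDef.eq 1 0 rfl) a

theorem exists_unordered [Model M] (a b : M) : ∃ s : M, ∀ z, z ∈' s ↔ z = a ∨ z = b :=
  SDef.comprehension₂ ![0, 0, 0] (R := fun a b z => z = a ∨ z = b)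
    ((SDef.eq 2 0 rfl).or (SDef.eq 2 1 rfl)) a b

theorem IsPair.inj [Model M] {p a b c d : M} (h : IsPair p a b) (h' : IsPair p c d) :
    a = c ∧ b = d := by
  obtain ⟨s, hs⟩ := exists_singleton a
  obtain ⟨t, ht⟩ := exists_unordered a b
  obtain ⟨s', hs'⟩ := exists_singleton c
  obtain ⟨t', ht'⟩ := exists_unordered c d
  have h1 := (h' s).1 ((h s).2 (Or.inl hs))
  have h2 := (h' t).1 ((h t).2 (Or.inr ht))
  have h3 := (h s').1 ((h' s').2 (Or.inl hs'))
  have h4 := (h t').1 ((h' t').2 (Or.inr ht'))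
  simp only [IsSingleton] at *
  simp only [hs, ht, hs', ht'] at h1 h2 h3 h4
  clear h h' hs ht hs' ht'
  have ac : a = c := by
    rcases h1 with h1 | h1
    · exact (h1 a).1 rfl
    · exact ((h1 c).2 (Or.inl rfl)).symm
  subst ac
  refine ⟨rfl, ?_⟩
  rcases h2 with h2 | h2
  · have hb : b = a := (h2 b).1 (Or.inr rfl)
    subst hb
    rcases h4 with h4 | h4
    · exact ((h4 d).1 (Or.inr rfl)).symm
    · have := (h4 d).1 (Or.inr rfl)
      exact (by simpa using this : d = b).symm
  · rcases (h2 b).1 (Or.inr rfl) with hb | hb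
    · subst hb
      have := (h2 d).2 (Or.inr rfl)
      exact (by simpa using this : d = b).symm
    · exact hb

theorem graphIsSet_id [Model M] (A : M) : GraphIsSet (fun x y : M => x ∈' A ∧ y = x) :=
  SDef.comprehension₁ ![1, 2] (R := fun A p => ∃ x y, (x ∈' A ∧ y = x) ∧ IsPair p x y)
    (SDef.ex (R := fun v x => ∃ y, (x ∈' v 0 ∧ y = x) ∧ IsPair (v 1) x y) 0
      (SDef.ex (R := fun v y => (v 2 ∈' v 0 ∧ y = v 2) ∧ IsPair (v 1) (v 2) y) 0
        (((SDef.mem 2 0 rfl).and (SDef.eq 3 2 rfl)).and (SDef.pair 1 2 3 rfl rfl)))) A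

theorem graphIsSet_comp [Model M] {R S : M → M → Prop} (hR : GraphIsSet R) (hS : GraphIsSet S) :
    GraphIsSet (fun x z => ∃ y, R x y ∧ S y z) := by
  obtain ⟨g, hg⟩ := hR
  obtain ⟨h, hh⟩ := hS
  have key : ∀ {T : M → M → Prop} {k : M},
      (∀ p, p ∈' k ↔ ∃ x y, T x y ∧ IsPair p x y) →
      ∀ x y, T x y ↔ ∃ q, q ∈' k ∧ IsPair q x y := by
    intro T k hk x y
    constructor
    · intro hT
      obtain ⟨q, hq⟩ := exists_pair x y
      exact ⟨q, (hk q).2 ⟨x, y, hT, hq⟩, hq⟩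
    · rintro ⟨q, hq, hp⟩
      obtain ⟨x', y', hT, hp'⟩ := (hk q).1 hq
      obtain ⟨rfl, rfl⟩ := hp.inj hp'
      exact hT
  simp only [GraphIsSet, key hg, key hh]
  exact SDef.comprehension₂ ![3, 3, 2] (R := fun g h p => ∃ x z,
      (∃ y, (∃ q, q ∈' g ∧ IsPair q x y) ∧ ∃ q, q ∈' h ∧ IsPair q y z) ∧ IsPair p x z)
    (SDef.ex (R := fun v x => ∃ z,
      (∃ y, (∃ q, q ∈' v 0 ∧ IsPair q x y) ∧ ∃ q, q ∈' v 1 ∧ IsPair q y z) ∧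
        IsPair (v 2) x z) 0
    (SDef.ex (R := fun v z =>
      (∃ y, (∃ q, q ∈' v 0 ∧ IsPair q (v 3) y) ∧ ∃ q, q ∈' v 1 ∧ IsPair q y z) ∧
        IsPair (v 2) (v 3) z) 0
    ((SDef.ex (R := fun v y => (∃ q, q ∈' v 0 ∧ IsPair q (v 3) y) ∧
        ∃ q, q ∈' v 1 ∧ IsPair q y (v 4)) 0
      ((SDef.ex (R := fun v q => q ∈' v 0 ∧ IsPair q (v 3) (v 5)) 2
          ((SDef.mem 6 0 rfl).and (SDef.pair 6 3 5 rfl rfl))).and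
        (SDef.ex (R := fun v q => q ∈' v 1 ∧ IsPair q (v 5) (v 4)) 2
          ((SDef.mem 6 1 rfl).and (SDef.pair 6 5 4 rfl rfl))))).and
      (SDef.pair 2 3 4 rfl rfl)))) g h

/-! ### Natural numbers and the Axiom of Counting -/

/-- `z = {∅}`, the Frege numeral zero. -/
def IsZero (z : M) : Prop := ∀ x, x ∈' z ↔ ∀ w, ¬ w ∈' x

/-- `n` is the successor of `m`: the set of all `y ∪ {a}` with `y ∈ m` and `a ∉ y`. -/
def IsSucc (m n : M) : Prop :=
  ∀ x, x ∈' n ↔ ∃ y a, y ∈' m ∧ ¬ a ∈' y ∧ ∀ w, w ∈' x ↔ w ∈' y ∨ w = a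

/-- `n` is a natural number: it belongs to every set that contains zero and is closed under
successors. -/
def IsNat (n : M) : Prop :=
  ∀ I : M, (∀ z, IsZero z → z ∈' I) → (∀ m m', m ∈' I → IsSucc m m' → m' ∈' I) → n ∈' I

/-- The order of cardinal numbers. -/
def NatLE (m n : M) : Prop := ∃ x y, x ∈' m ∧ y ∈' n ∧ Sub x y

variable (M) in
/-- Rosser's Axiom of Counting: for each natural number `n`, the set `{m | 1 ≤ m ≤ n}` of natural
numbers has `n` elements. -/
def AxiomOfCounting : Prop :=
  ∀ n : M, IsNat n → ∃ s : M, (∀ m, m ∈' s ↔ IsNat m ∧ ¬ IsZero m ∧ NatLE m n) ∧ s ∈' n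

end Sets

/-! ### The category of sets of a model of NF -/

/-- The objects of the category of sets of `M` are the elements of `M`. -/
structure SetCat (M : Type u) where
  carrier : M

variable {M : Type u} [setLang.Structure M]

/-- The type of the members of a set of `M`. -/
def SetCat.Elem (A : SetCat M) : Type u := {x : M // x ∈' A.carrier}

/-- The morphisms are the functions whose graph is a set of `M`. -/
@[ext]
structure SetCat.Hom (A B : SetCat M) where
  toFun : A.Elem → B.Elem
  graphIsSet : GraphIsSet (fun x y : M => ∃ h : x ∈' A.carrier, y = (toFun ⟨x, h⟩).1)

instance SetCat.category [Model M] : Category (SetCat M) where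
  Hom A B := SetCat.Hom A B
  id A := ⟨fun x => x, by
    have h := graphIsSet_id A.carrier
    simpa only [exists_prop] using h⟩
  comp {A B C} f g := ⟨fun x => g.toFun (f.toFun x), by
    have h := graphIsSet_comp f.graphIsSet g.graphIsSet
    have e : (fun x z : M => ∃ y, (∃ h : x ∈' A.carrier, y = (f.toFun ⟨x, h⟩).1) ∧
        ∃ h : y ∈' B.carrier, z = (g.toFun ⟨y, h⟩).1) =
        fun x z : M => ∃ h : x ∈' A.carrier, z = (g.toFun (f.toFun ⟨x, h⟩)).1 := by
      funext x z
      apply propext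
      constructor
      · rintro ⟨y, ⟨hx, rfl⟩, _, hz⟩
        exact ⟨hx, hz⟩
      · rintro ⟨hx, hz⟩
        exact ⟨_, ⟨hx, rfl⟩, (f.toFun ⟨x, hx⟩).2, hz⟩
    rwa [e] at h⟩

/-- The value of a morphism at a member of its domain, as an element of `M`. -/
def SetCat.app [Model M] {A B : SetCat M} (f : A ⟶ B) (x : A.Elem) : M :=
  (SetCat.Hom.toFun f x).1

variable (M) in
/-- Being strongly cantorian, as a property of objects. -/
def stronglyCantorian [Model M] : ObjectProperty (SetCat M) :=
  fun A => StronglyCantorian A.carrier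

variable (M) in
/-- The full subcategory of the strongly cantorian sets. -/
abbrev SC [Model M] : Type u := (stronglyCantorian M).FullSubcategory

/-! ### Toposes -/

/-- An elementary topos: finite limits, exponentials (each `A × -` has a right adjoint), and a
subobject classifier. -/
structure IsElementaryTopos (C : Type*) [Category C] : Prop where
  hasFiniteLimits : HasFiniteLimits C
  cartesianClosed : ∀ A : C, (prod.functor.obj A).IsLeftAdjoint
  hasSubobjectClassifier : HasSubobjectClassifier C

/-- The functor `Sub(A × -)`. -/
noncomputable def subProd {C : Type u} [Category.{u} C] [HasFiniteLimits C] (A : C) :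
    Cᵒᵖ ⥤ Type u :=
  (prod.functor.obj A).op ⋙ Subobject.presheaf C

/-- There is a natural numbers object `1 → N → N`. -/
def HasNNO (C : Type*) [Category C] : Prop :=
  ∃ (T N : C) (_ : IsTerminal T) (z : T ⟶ N) (s : N ⟶ N),
    ∀ (X : C) (x : T ⟶ X) (f : X ⟶ X), ∃! h : N ⟶ X, z ≫ h = x ∧ s ≫ h = h ≫ f

/-- `TA`, the set of singletons of members of `A`. -/
noncomputable def SetCat.T [Model M] (A : SetCat M) : SetCat M := ⟨singletons A.carrier⟩

/-- The power set of `A`. -/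
noncomputable def SetCat.P [Model M] (A : SetCat M) : SetCat M := ⟨power A.carrier⟩

end NF

/-! Everything is bookkeeping of types. The graph of a relation is a set exactly when a stratified
formula with parameters defines the relation with both arguments at the same type
(`graphIsSet_iff`), and `A` is strongly cantorian exactly when equality on `A` is definable with its
two sides one type apart (`stronglyCantorian_iff`). Composing such shifts makes equality on `A`
definable between any two types (`StronglyCantorian.pdef`), so a variable confined to a strongly
cantorian set can be copied to whatever type a formula needs. Definability is meant in the sense of
`PDef`: parameters carry no type, and types count only up to a common shift.

Copying variables gives closure under subsets, power sets, products and definable images. It also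
turns a definable function into a strongly cantorian set into a morphism when argument and value
have different types (`exists_hom_of_sc_right`). Projections, pairing, evaluation and transposition
all change types, and all are obtained this way.

In the relation `a ∈ f(b)` the element `a` lies one type below `f(b)`, hence below `b`. To be paired
with `b`, it must be replaced by something one type higher: `{a}` for arbitrary `A`, or `a` itself
if `A` is strongly cantorian. `SubsetClosed.exists_equiv_subobject` covers both through a relation
`E`, and both categories through `SubsetClosed`. The subobject classifier is the power set of a
terminal object.

For the natural numbers, let `T n` be the number of singletons of members of a set with `n`
elements; `T` raises types by one. The Axiom of Counting makes equality of numbers definable two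
types apart, so `T (T n) = n` can be proved by stratified induction. Since `T` is monotone for a
total order, `T n = n`, and the graph of `T` exhibits the set of numbers as strongly cantorian. The
recursion theorem then needs only that numerals are nonempty, which the axiom also gives. -/

namespace NF

/-! ### Stratified definability with untyped parameters -/

section Definability

theorem termType_add {β : Type} (σ : β → ℕ) (d : ℕ) (t : setLang.Term β) :
    termType (fun b => σ b + d) t = termType σ t + d := by
  cases t with
  | var b => rfl
  | func f _ => exact Empty.elim f

theorem termType_relabel {β γ : Type} (σ : γ → ℕ) (f : β → γ) (t : setLang.Term β) :
    termType σ (t.relabel f) = termType (σ ∘ f) t := by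
  cases t with
  | var b => rfl
  | func f _ => exact Empty.elim f

/-- Renaming of the variables of a formula. -/
theorem exists_rename (M : Type u) [setLang.Structure M] {m : ℕ}
    (φ : setLang.BoundedFormula Empty m) : ∀ {n : ℕ} (f : Fin m → Fin n) (d : ℕ),
    ∃ ψ : setLang.BoundedFormula Empty n,
      (∀ τ : Fin m → ℕ, Stratifies φ τ → ∀ σ : Fin n → ℕ, (∀ i, σ (f i) = τ i + d) →
        Stratifies ψ σ) ∧
      ∀ w : Fin n → M, ψ.Realize (default : Empty → M) w ↔
        φ.Realize (default : Empty → M) (fun i => w (f i)) := by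
  have ht : ∀ {m n : ℕ} (f : Fin m → Fin n) (d : ℕ) (t : setLang.Term (Empty ⊕ Fin m))
      (τ : Fin m → ℕ) (σ : Fin n → ℕ), (∀ i, σ (f i) = τ i + d) →
      termType (Sum.elim Empty.elim σ) (t.relabel (Sum.map id f)) =
        termType (Sum.elim Empty.elim τ) t + d := by
    intro m n f d t τ σ h
    rw [termType_relabel, ← termType_add]
    congr 1
    funext b
    rcases b with b | b
    · exact b.elim
    · exact h b
  have hr : ∀ {m n : ℕ} (f : Fin m → Fin n) (t : setLang.Term (Empty ⊕ Fin m)) (w : Fin n → M),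
      (t.relabel (Sum.map id f)).realize (Sum.elim (default : Empty → M) w) =
        t.realize (Sum.elim (default : Empty → M) (fun i => w (f i))) := by
    intro m n f t w
    rw [FirstOrder.Language.Term.realize_relabel]
    congr 1
    funext b
    rcases b with b | b
    · exact b.elim
    · rfl
  induction φ with
  | falsum => exact fun {n} f d => ⟨.falsum, fun _ _ _ _ => trivial, fun _ => Iff.rfl⟩
  | equal t₁ t₂ =>
    refine fun {n} f d => ⟨.equal (t₁.relabel (Sum.map id f)) (t₂.relabel (Sum.map id f)), ?_, ?_⟩
    · intro τ h σ hσ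
      simp only [Stratifies] at h ⊢
      rw [ht f d _ τ σ hσ, ht f d _ τ σ hσ, h]
    · intro w
      simp only [FirstOrder.Language.BoundedFormula.Realize, hr]
  | rel R ts =>
    refine fun {n} f d => ⟨.rel R (fun i => (ts i).relabel (Sum.map id f)), ?_, ?_⟩
    · intro τ h σ hσ
      cases R
      simp only [Stratifies] at h ⊢
      rw [ht f d _ τ σ hσ, ht f d _ τ σ hσ, ← h]
      omega
    · intro w
      simp only [FirstOrder.Language.BoundedFormula.Realize, hr]
  | imp φ ψ ihφ ihψ =>
    intro n f d
    obtain ⟨φ', h1, h2⟩ := ihφ f d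
    obtain ⟨ψ', h3, h4⟩ := ihψ f d
    exact ⟨.imp φ' ψ', fun τ h σ hσ => ⟨h1 τ h.1 σ hσ, h3 τ h.2 σ hσ⟩,
      fun w => imp_congr (h2 w) (h4 w)⟩
  | @all m φ ih =>
    intro n f d
    obtain ⟨φ', h1, h2⟩ :=
      ih (Fin.snoc (α := fun _ => Fin (n + 1)) (fun i => (f i).castSucc) (Fin.last n)) d
    refine ⟨.all φ', fun τ h σ hσ => ?_, fun w => forall_congr' fun x => (h2 _).trans ?_⟩
    · obtain ⟨k, hk⟩ := h
      -- The bound variable is shifted along with the free ones.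
      refine ⟨k + d, h1 _ hk _ fun i => ?_⟩
      induction i using Fin.lastCases with
      | last => simp
      | cast i => simp [hσ]
    · apply iff_of_eq
      congr 1
      funext i
      induction i using Fin.lastCases with
      | last => simp
      | cast i => simp

variable {M : Type u} [setLang.Structure M]

theorem SDef.rename {m n : ℕ} {τ : Fin m → ℕ} {R : (Fin m → M) → Prop} (h : SDef τ R)
    {σ : Fin n → ℕ} (f : Fin m → Fin n) (d : ℕ) (hf : ∀ i, σ (f i) = τ i + d) :
    SDef σ (fun w => R (fun i => w (f i))) := by
  obtain ⟨φ, h1, h2⟩ := h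
  obtain ⟨ψ, h3, h4⟩ := exists_rename M φ f d
  exact ⟨ψ, h3 τ h1 σ hf, fun w => (h4 w).trans (h2 _)⟩

/-- The condition `R` is defined by a formula with constants from `M` that, up to a shift,
`σ` stratifies; the constants have no types. -/
def PDef {n : ℕ} (σ : Fin n → ℕ) (R : (Fin n → M) → Prop) : Prop :=
  ∃ (d m : ℕ) (τ : Fin m → ℕ) (Q : (Fin m → M) → Prop) (ρ : Fin m → Fin n ⊕ M),
    SDef τ Q ∧ (∀ i j, ρ i = .inl j → τ i = σ j + d) ∧
      ∀ v, R v ↔ Q (fun i => Sum.elim v id (ρ i))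

theorem SDef.pdef {n : ℕ} {σ : Fin n → ℕ} {R : (Fin n → M) → Prop} (h : SDef σ R) : PDef σ R :=
  ⟨0, n, σ, R, .inl, h, fun i j e => by rw [Sum.inl.inj e]; rfl, fun _ => Iff.rfl⟩

namespace PDef

variable {n : ℕ} {σ : Fin n → ℕ} {R S : (Fin n → M) → Prop}

theorem congr (h : PDef σ R) (e : ∀ v, R v ↔ S v) : PDef σ S := by
  obtain ⟨d, m, τ, Q, ρ, h1, h2, h3⟩ := h
  exact ⟨d, m, τ, Q, ρ, h1, h2, fun v => (e v).symm.trans (h3 v)⟩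

/-- Shifts occur on both sides of `hf` because types are natural numbers, so lowering every type by
a constant must be expressed by raising the other side. -/
theorem rename (h : PDef σ R) {m : ℕ} {τ : Fin m → ℕ} (f : Fin n → Fin m) (d d' : ℕ)
    (hf : ∀ i, τ (f i) + d' = σ i + d) : PDef τ (fun w => R (fun i => w (f i))) := by
  obtain ⟨e, k, τ', Q, ρ, h1, h2, h3⟩ := h
  refine ⟨d' + e, k, fun i => τ' i + d, Q, fun i => (ρ i).map f id, h1.rename id d (fun _ => rfl),
    fun i j hj => ?_, fun v => (h3 _).trans (iff_of_eq ?_)⟩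
  · beta_reduce at hj
    rcases hi : ρ i with j' | c
    · rw [hi] at hj
      cases hj
      have := hf j'
      have := h2 i j' hi
      beta_reduce
      omega
    · rw [hi] at hj
      cases hj
  · congr 1
    funext i
    beta_reduce
    rcases ρ i with j' | c <;> rfl

theorem imp (hR : PDef σ R) (hS : PDef σ S) : PDef σ (fun v => R v → S v) := by
  obtain ⟨d, m, τ, Q, ρ, h1, h2, h3⟩ := hR
  obtain ⟨d', m', τ', Q', ρ', h1', h2', h3'⟩ := hS
  -- Each formula is raised by the other's shift, so that both end with the shift `d + d'`. The
  -- slots are kept disjoint; several slots may stand for the same variable or constant.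
  refine ⟨d + d', m + m', Fin.append (fun i => τ i + d') (fun i => τ' i + d),
    fun w => Q (fun i => w (i.castAdd m')) → Q' (fun i => w (i.natAdd m)),
    Fin.append ρ ρ', ?_, ?_, ?_⟩
  · exact (h1.rename _ d' (by simp)).imp (h1'.rename _ d (by simp))
  · intro i j
    refine Fin.addCases (fun i hi => ?_) (fun i hi => ?_) i
    · have := h2 i j (by simpa using hi)
      simp only [Fin.append_left]
      omega
    · have := h2' i j (by simpa using hi)
      simp only [Fin.append_right]
      omega
  · intro v
    simp [h3, h3']

theorem const (p : Prop) : PDef (M := M) σ (fun _ => p) := by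
  by_cases hp : p
  · exact ⟨0, 0, Fin.elim0, fun _ => p, fun i => i.elim0,
      ⟨.imp .falsum .falsum, ⟨trivial, trivial⟩, fun _ => ⟨fun _ => hp, fun _ h => h⟩⟩,
      fun i => i.elim0, fun _ => Iff.rfl⟩
  · exact ⟨0, 0, Fin.elim0, fun _ => p, fun i => i.elim0,
      ⟨.falsum, trivial, fun _ => ⟨False.elim, hp⟩⟩, fun i => i.elim0, fun _ => Iff.rfl⟩

theorem not (hR : PDef σ R) : PDef σ (fun v => ¬ R v) := hR.imp (const False)

theorem or (hR : PDef σ R) (hS : PDef σ S) : PDef σ (fun v => R v ∨ S v) :=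
  (hR.not.imp hS).congr fun _ => or_iff_not_imp_left.symm

theorem and (hR : PDef σ R) (hS : PDef σ S) : PDef σ (fun v => R v ∧ S v) :=
  (hR.imp hS.not).not.congr fun v => by tauto

theorem iff (hR : PDef σ R) (hS : PDef σ S) : PDef σ (fun v => R v ↔ S v) :=
  ((hR.imp hS).and (hS.imp hR)).congr fun v => by tauto

theorem mem (i j : Fin n) (h : σ i + 1 = σ j
      := by first | rfl | (simp; done) | (simp; omega)) :
    PDef σ (fun v : Fin n → M => v i ∈' v j) :=
  (SDef.mem i j h).pdef

theorem eq (i j : Fin n) (h : σ i = σ j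
      := by first | rfl | (simp; done) | (simp; omega)) : PDef σ (fun v : Fin n → M => v i = v j) :=
  (SDef.eq i j h).pdef

theorem mem_const (i : Fin n) (c : M) : PDef σ (fun v => v i ∈' c) :=
  ⟨0, 2, ![σ i, σ i + 1], fun w => w 0 ∈' w 1, ![.inl i, .inr c], SDef.mem 0 1 rfl,
    Fin.forall_fin_two.2 ⟨fun j h => by cases h; rfl, nofun⟩, fun _ => Iff.rfl⟩

theorem const_mem (i : Fin n) (c : M) : PDef σ (fun v => c ∈' v i) :=
  -- The constant sits one type below the variable, which may have type `0`; hence the shift by one.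
  ⟨1, 2, ![σ i, σ i + 1], fun w => w 0 ∈' w 1, ![.inr c, .inl i], SDef.mem 0 1 rfl,
    Fin.forall_fin_two.2 ⟨nofun, fun j h => by cases h; rfl⟩, fun _ => Iff.rfl⟩

theorem eq_const (i : Fin n) (c : M) : PDef σ (fun v => v i = c) :=
  ⟨0, 2, ![σ i, σ i], fun w => w 0 = w 1, ![.inl i, .inr c], SDef.eq 0 1 rfl,
    Fin.forall_fin_two.2 ⟨fun j h => by cases h; rfl, nofun⟩, fun _ => Iff.rfl⟩

/-- The quantified variable is the last one; it gets the value `k`. -/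
theorem all (k : ℕ) {R : (Fin n → M) → M → Prop}
    (h : PDef (Fin.snoc (α := fun _ => ℕ) σ k)
      (fun w : Fin (n + 1) → M => R (fun i => w i.castSucc) (w (Fin.last n)))) :
    PDef σ (fun v => ∀ x, R v x) := by
  rcases isEmpty_or_nonempty M with hM | ⟨⟨c⟩⟩
  · exact (const True).congr fun v => ⟨fun _ x => hM.elim x, fun _ => trivial⟩
  obtain ⟨d, m, τ, Q, ρ, h1, h2, h3⟩ := h
  classical
  -- All slots held by the quantified variable are replaced by the single bound variable `x`. They
  -- no longer matter, and are filled with an arbitrary constant `c`.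
  refine ⟨d, m, τ, fun w => ∀ x, Q (fun i => if ρ i = .inl (Fin.last n) then x else w i),
    fun i => (ρ i).elim (Fin.lastCases (.inr c) .inl) .inr,
    SDef.all (k + d) ?_, fun i j hj => ?_, fun v => forall_congr' fun x => ?_⟩
  · have := h1.rename (σ := Fin.snoc (α := fun _ => ℕ) τ (k + d))
      (fun i => if ρ i = .inl (Fin.last n) then Fin.last m else i.castSucc) 0 ?_
    · refine this.congr fun v => iff_of_eq ?_
      congr 1
      funext i
      split_ifs <;> rfl
    · intro i
      split_ifs with hi
      · simp [h2 i _ hi]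
      · simp
  · beta_reduce at hj
    rcases hi : ρ i with j' | c'
    · rw [hi] at hj
      revert hj hi
      refine Fin.lastCases (fun hj _ => ?_) (fun j'' hj hi => ?_) j'
      · simp at hj
      · have := h2 i _ hi
        simp at hj
        subst hj
        simpa using this
    · rw [hi] at hj
      cases hj
  · have := h3 (Fin.snoc (α := fun _ => M) v x)
    simp only [Fin.snoc_castSucc, Fin.snoc_last] at this
    rw [this]
    apply iff_of_eq
    congr 1
    funext i
    rcases hi : ρ i with j' | c'
    · clear this
      revert hi
      refine Fin.lastCases (fun _ => ?_) (fun j'' hi => ?_) j'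
      · simp
      · simp [hi, Fin.castSucc_ne_last]
    · simp [hi]

/-- The quantified variable is the last one; it gets the value `k`. -/
theorem ex (k : ℕ) {R : (Fin n → M) → M → Prop}
    (h : PDef (Fin.snoc (α := fun _ => ℕ) σ k)
      (fun w : Fin (n + 1) → M => R (fun i => w i.castSucc) (w (Fin.last n)))) :
    PDef σ (fun v => ∃ x, R v x) :=
  (PDef.all (R := fun v x => ¬ R v x) k h.not).not.congr fun v => by simp

theorem singleton (s i : Fin n) (h : σ i + 1 = σ s
      := by first | rfl | (simp; done) | (simp; omega)) :
    PDef σ (fun v : Fin n → M => IsSingleton (v s) (v i)) :=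
  (SDef.singleton s i h).pdef

theorem pair (p i j : Fin n) (hij : σ j = σ i := by first | rfl | (simp; done) | (simp; omega))
    (hp : σ i + 2 = σ p := by first | rfl | (simp; done) | (simp; omega)) :
    PDef σ (fun v : Fin n → M => IsPair (v p) (v i) (v j)) :=
  (SDef.pair p i j hij hp).pdef

/-- Stratified comprehension. -/
theorem comprehension [Model M] {k : ℕ} {R : M → Prop} (h : PDef ![k] (fun v => R (v 0))) :
    ∃ y : M, ∀ z, z ∈' y ↔ R z := by
  obtain ⟨d, m, τ, Q, ρ, h1, h2, h3⟩ := h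
  classical
  -- Any element will do: it fills the parameter slots that stood for the variable `z`, which the
  -- renaming below moves to the last place.
  obtain ⟨y₀, -⟩ := Model.comprehension (M := M) 0 .falsum ⟨fun _ => 0, trivial⟩ Fin.elim0
  have := h1.rename (σ := Fin.snoc (α := fun _ => ℕ) τ (k + d))
    (fun i => if ρ i = .inl 0 then Fin.last m else i.castSucc) 0 ?_
  · obtain ⟨φ, h4, h5⟩ := this
    obtain ⟨y, hy⟩ := Model.comprehension m φ ⟨_, h4⟩ (fun i => (ρ i).elim (fun _ => y₀) id)
    refine ⟨y, fun z => (hy z).trans ((h5 _).trans (.trans (iff_of_eq ?_) (h3 (fun _ => z)).symm))⟩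
    beta_reduce
    congr 1
    funext i
    rcases hi : ρ i with j' | c'
    · have : j' = 0 := Subsingleton.elim _ _
      subst this
      simp
    · simp [hi]
  · intro i
    split_ifs with hi
    · simp [h2 i _ hi]
    · simp

/-- A definable relation at two variables, up to a shift of types. -/
theorem rel {a b : ℕ} {R : M → M → Prop} (h : PDef ![a, b] (fun v => R (v 0) (v 1)))
    (i j : Fin n) (hij : σ i + b = σ j + a
      := by first | rfl | (simp; done) | (simp; omega)) : PDef σ (fun v => R (v i) (v j)) := by
  refine h.rename (τ := σ) ![i, j] (σ i) a fun k => ?_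
  fin_cases k
  · exact Nat.add_comm _ _
  · change σ j + a = b + σ i
    omega

theorem rel' {a : ℕ} {R : M → Prop} (h : PDef ![a] (fun v => R (v 0)))
    (i : Fin n) : PDef σ (fun v => R (v i)) := by
  refine h.rename (τ := σ) ![i] (σ i) a fun k => ?_
  fin_cases k
  exact Nat.add_comm _ _

end PDef

end Definability
-- Strongly cantorian sets and morphisms in terms of definability
section Definable

variable {M : Type u} [setLang.Structure M] {n : ℕ} {σ : Fin n → ℕ}

/-- A constant may be substituted for a variable. -/
theorem PDef.inst (k : ℕ) {R : (Fin n → M) → M → Prop} (c : M)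
    (h : PDef (Fin.snoc (α := fun _ => ℕ) σ k)
      (fun w : Fin (n + 1) → M => R (fun i => w i.castSucc) (w (Fin.last n)))) :
    PDef σ (fun v => R v c) :=
  (PDef.ex (R := fun v x => x = c ∧ R v x) k (.and (.eq_const _ c) h)).congr fun v => by simp

theorem PDef.sub (i j : Fin n) (h : σ i = σ j := by first | rfl | (simp; done) | (simp; omega)) :
    PDef σ (fun v : Fin n → M => Sub (v i) (v j)) := by
  refine PDef.rel (R := Sub) (a := 1) (b := 1) ?_ i j (by omega)
  exact .all 0 (.imp (.mem _ _) (.mem _ _))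

theorem PDef.sub_const (i : Fin n) (c : M) : PDef σ (fun v : Fin n → M => Sub (v i) c) :=
  PDef.rel' (a := 1) (R := fun x => Sub x c) (.all 0 (.imp (.mem _ _) (.mem_const _ _))) i

theorem IsSingleton.inj {s x y : M} (h : IsSingleton s x) (h' : IsSingleton s y) : x = y :=
  (h' x).1 ((h x).2 rfl)

variable [Model M]

theorem IsSingleton.unique {s t x : M} (h : IsSingleton s x) (h' : IsSingleton t x) : s = t :=
  Model.extensionality _ _ fun z => (h z).trans (h' z).symm

theorem IsPair.unique {p q x y : M} (h : IsPair p x y) (h' : IsPair q x y) : p = q :=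
  Model.extensionality _ _ fun z => (h z).trans (h' z).symm

/-- An ordered pair lies two types above both of its components. This forces equal types on the two
arguments, and nothing else. -/
theorem graphIsSet_iff {R : M → M → Prop} :
    GraphIsSet R ↔ PDef ![0, 0] (fun v : Fin 2 → M => R (v 0) (v 1)) := by
  constructor
  · rintro ⟨g, hg⟩
    refine PDef.congr (R := fun v => ∃ q, q ∈' g ∧ IsPair q (v 0) (v 1))
      (.ex 2 (.and (.mem_const _ _) (.pair _ _ _))) fun v => ?_
    constructor
    · rintro ⟨q, hq, hp⟩
      obtain ⟨x', y', hT, hp'⟩ := (hg q).1 hq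
      obtain ⟨h1, h2⟩ := hp.inj hp'
      rwa [h1, h2]
    · intro h
      obtain ⟨q, hq⟩ := exists_pair (v 0) (v 1)
      exact ⟨q, (hg q).2 ⟨_, _, h, hq⟩, hq⟩
  · intro h
    exact PDef.comprehension (k := 2) (R := fun p => ∃ x y, R x y ∧ IsPair p x y)
      (.ex 0 (.ex 0 (.and (h.rel _ _) (.pair _ _ _))))

/-- The map `x ↦ {x}` between equal types and equality with a type difference of one determine each
other: `y = x` means `y ∈ {x}`, and `s = {x}` means that `s` is the singleton of a copy of `x` one
type lower. -/
theorem stronglyCantorian_iff {A : M} : StronglyCantorian A ↔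
    PDef ![1, 0] (fun v : Fin 2 → M => v 0 ∈' A ∧ v 1 = v 0) := by
  rw [StronglyCantorian, graphIsSet_iff]
  constructor
  · intro h
    refine PDef.congr (R := fun v => ∃ s, (v 0 ∈' A ∧ IsSingleton s (v 0)) ∧ v 1 ∈' s)
      (.ex 1 (.and (h.rel (R := fun x s => x ∈' A ∧ IsSingleton s x) _ _) (.mem _ _)))
      fun v => ?_
    constructor
    · rintro ⟨s, ⟨h1, h2⟩, h3⟩
      exact ⟨h1, (h2 _).1 h3⟩
    · rintro ⟨h1, h2⟩
      obtain ⟨s, hs⟩ := exists_singleton (v 0)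
      exact ⟨s, ⟨h1, hs⟩, (hs _).2 h2⟩
  · intro h
    refine PDef.rel (a := 1) (b := 1) (R := fun x s => x ∈' A ∧ IsSingleton s x) ?_ 0 1 rfl
    refine PDef.congr (R := fun v => ∃ y, (v 0 ∈' A ∧ y = v 0) ∧ IsSingleton (v 1) y)
      (.ex 0 (.and (h.rel (R := fun x y => x ∈' A ∧ y = x) _ _) (.singleton _ _)))
      fun v => ?_
    simp

namespace StronglyCantorian

variable {A B : M}

/-- Equality on a strongly cantorian set is definable between any two types. -/
theorem pdef (hA : StronglyCantorian A) (i j : Fin n) :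
    PDef σ (fun v : Fin n → M => v i ∈' A ∧ v j = v i) := by
  have h0 := stronglyCantorian_iff.1 hA
  -- A gap of `d` types is bridged by composing `d` copies of equality across one type.
  have h : ∀ d, PDef ![d, 0] (fun v : Fin 2 → M => v 0 ∈' A ∧ v 1 = v 0) := by
    intro d
    induction d with
    | zero => exact .and (.mem_const _ _) (.eq _ _)
    | succ d ih =>
      refine PDef.congr (R := fun v => ∃ z, (v 0 ∈' A ∧ z = v 0) ∧ z ∈' A ∧ v 1 = z)
        (.ex d (.and (h0.rel (R := fun x y => x ∈' A ∧ y = x) _ _)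
          (ih.rel (R := fun x y => x ∈' A ∧ y = x) _ _))) fun v => ?_
      constructor
      · rintro ⟨z, ⟨h1, rfl⟩, _, h2⟩
        exact ⟨h1, h2⟩
      · rintro ⟨h1, h2⟩
        exact ⟨_, ⟨h1, rfl⟩, h1, h2⟩
  rcases le_total (σ i) (σ j) with hij | hij
  · refine PDef.congr ((h (σ j - σ i)).rel (R := fun x y => x ∈' A ∧ y = x) j i (by omega))
      fun v => ?_
    constructor <;> rintro ⟨h1, h2⟩ <;> rw [h2] <;> exact ⟨h1, rfl⟩
  · exact (h (σ i - σ j)).rel (R := fun x y => x ∈' A ∧ y = x) i j (by omega)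

/-- The second argument is replaced by an equal element of `A` at the type that `R` wants. -/
theorem retype_right (hA : StronglyCantorian A) {a b : ℕ} {R : M → M → Prop}
    (h : PDef ![a, b] (fun v => R (v 0) (v 1))) (hR : ∀ x y, R x y → y ∈' A) (c : ℕ) :
    PDef ![a, c] (fun v => R (v 0) (v 1)) :=
  PDef.congr (R := fun v => ∃ z, (v 1 ∈' A ∧ z = v 1) ∧ R (v 0) z)
    (.ex b (.and (hA.pdef _ _) (h.rel _ _))) fun _ =>
      ⟨fun ⟨_, ⟨_, hz⟩, hr⟩ => hz ▸ hr, fun hr => ⟨_, ⟨hR _ _ hr, rfl⟩, hr⟩⟩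

theorem subset (hA : StronglyCantorian A) (h : Sub B A) : StronglyCantorian B :=
  stronglyCantorian_iff.2 <| PDef.congr (R := fun v => v 0 ∈' B ∧ v 0 ∈' A ∧ v 1 = v 0)
    (.and (.mem_const _ _) (hA.pdef _ _)) fun _ =>
      ⟨fun ⟨h1, _, h2⟩ => ⟨h1, h2⟩, fun ⟨h1, h2⟩ => ⟨h1, h _ h1, h2⟩⟩

/-- Two subsets of `A` at adjacent types are compared by comparing their members, which lie in `A`
and so can be identified across the gap. -/
theorem power (hA : StronglyCantorian A) : StronglyCantorian (power A) := by
  refine stronglyCantorian_iff.2 <| PDef.rel (a := 2) (b := 1)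
    (R := fun X Y => X ∈' NF.power A ∧ Y = X) ?_ _ _
  refine PDef.congr (R := fun v => Sub (v 0) A ∧ Sub (v 1) A ∧
    ∀ x y, (x ∈' A ∧ y = x) → (x ∈' v 0 ↔ y ∈' v 1))
    (.and (.sub_const _ _) (.and (.sub_const _ _) (.all 1 (.all 0 (.imp (hA.pdef _ _)
      (.iff (.mem _ _) (.mem _ _))))))) fun v => ?_
  rw [mem_power]
  constructor
  · rintro ⟨h1, h2, h3⟩
    refine ⟨h1, Model.extensionality _ _ fun z => ⟨fun hz => ?_, fun hz => ?_⟩⟩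
    · exact (h3 z z ⟨h2 _ hz, rfl⟩).2 hz
    · exact (h3 z z ⟨h1 _ hz, rfl⟩).1 hz
  · rintro ⟨h1, h2⟩
    rw [h2]
    refine ⟨h1, h1, ?_⟩
    rintro x y ⟨_, rfl⟩
    rfl

theorem cartesian (hA : StronglyCantorian A) (hB : StronglyCantorian B) :
    StronglyCantorian (cartesian A B) := by
  refine stronglyCantorian_iff.2 <| PDef.rel (a := 3) (b := 2)
    (R := fun X Y => X ∈' NF.cartesian A B ∧ Y = X) ?_ _ _
  refine PDef.congr (R := fun v => ∃ a b a' b', (a ∈' A ∧ a' = a) ∧ (b ∈' B ∧ b' = b) ∧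
    IsPair (v 0) a b ∧ IsPair (v 1) a' b')
    (.ex 1 (.ex 1 (.ex 0 (.ex 0 (.and (hA.pdef _ _) (.and (hB.pdef _ _)
      (.and (.pair _ _ _) (.pair _ _ _)))))))) fun v => ?_
  rw [mem_cartesian]
  constructor
  · rintro ⟨a, b, a', b', ⟨h1, rfl⟩, ⟨h2, rfl⟩, h3, h4⟩
    exact ⟨⟨_, _, ⟨h1, h2⟩, h3⟩, h4.unique h3⟩
  · rintro ⟨⟨a, b, ⟨h1, h2⟩, h3⟩, h4⟩
    rw [h4]
    exact ⟨a, b, a, b, ⟨h1, rfl⟩, ⟨h2, rfl⟩, h3, h3⟩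

/-- A definable image of a strongly cantorian set is strongly cantorian. -/
theorem image (hA : StronglyCantorian A) {a b : ℕ} {R : M → M → Prop}
    (h : PDef ![a, b] (fun v => R (v 0) (v 1))) (hf : ∀ x y y', R x y → R x y' → y = y')
    (hB : ∀ y, y ∈' B ↔ ∃ x, x ∈' A ∧ R x y) : StronglyCantorian B := by
  refine stronglyCantorian_iff.2 <| PDef.rel (a := b + 1) (b := b)
    (R := fun X Y => X ∈' B ∧ Y = X) ?_ _ _
  refine PDef.congr (R := fun v => ∃ x x', (x ∈' A ∧ x' = x) ∧ R x (v 0) ∧ R x' (v 1))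
    (.ex (a + 1) (.ex a (.and (hA.pdef _ _) (.and
      (h.rel _ _) (h.rel _ _)))))
    fun v => ?_
  rw [hB]
  constructor
  · rintro ⟨x, x', ⟨h1, rfl⟩, h2, h3⟩
    exact ⟨⟨_, h1, h2⟩, hf _ _ _ h3 h2⟩
  · rintro ⟨⟨x, h1, h2⟩, h3⟩
    rw [h3]
    exact ⟨x, x, ⟨h1, rfl⟩, h2, h2⟩

theorem singletons (hA : StronglyCantorian A) : StronglyCantorian (singletons A) :=
  hA.image (a := 0) (b := 1) (R := fun x s => IsSingleton s x) (.singleton _ _)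
    (fun _ _ _ h h' => h.unique h') fun _ => mem_singletons

/-- Equality on `{x}` says that both sides equal the constant `x`; constants are untyped, so the two
sides are unrelated in type. -/
theorem of_isSingleton {s x : M} (h : IsSingleton s x) : StronglyCantorian s :=
  stronglyCantorian_iff.2 <| PDef.congr (R := fun v => v 0 = x ∧ v 1 = x)
    (.and (.eq_const _ _) (.eq_const _ _)) fun v => by
      rw [h]
      constructor <;> rintro ⟨h1, h2⟩ <;> simp_all

end StronglyCantorian

/-! ### Morphisms -/

namespace SetCat

variable {A B C : SetCat M}

/-- The function underlying a morphism. -/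
def ev (f : A ⟶ B) : A.Elem → B.Elem := Hom.toFun f

@[simp] theorem ev_id (x : A.Elem) : ev (𝟙 A) x = x := rfl

@[simp] theorem ev_comp (f : A ⟶ B) (g : B ⟶ C) (x : A.Elem) : ev (f ≫ g) x = ev g (ev f x) := rfl

theorem hom_ext {f g : A ⟶ B} (h : ∀ x, ev f x = ev g x) : f = g :=
  Hom.ext (funext h)

/-- The graph of a morphism. -/
def Rel (f : A ⟶ B) (x y : M) : Prop := ∃ h : x ∈' A.carrier, y = (ev f ⟨x, h⟩).1

@[simp] theorem rel_iff (f : A ⟶ B) (x : A.Elem) (y : M) : Rel f x.1 y ↔ y = (ev f x).1 :=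
  ⟨fun ⟨_, h⟩ => h, fun h => ⟨x.2, h⟩⟩

theorem rel_iff' (f : A ⟶ B) {x y : M} : Rel f x y ↔ ∃ a : A.Elem, a.1 = x ∧ (ev f a).1 = y :=
  ⟨fun ⟨h, e⟩ => ⟨⟨x, h⟩, rfl, e.symm⟩, fun ⟨a, h, e⟩ => h ▸ ⟨a.2, e.symm⟩⟩

theorem _root_.NF.PDef.hom (f : A ⟶ B) (i j : Fin n)
    (h : σ i = σ j := by first | rfl | (simp; done) | (simp; omega)) :
    PDef σ (fun v => Rel f (v i) (v j)) :=
  (graphIsSet_iff.1 (Hom.graphIsSet f)).rel i j h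

/-- The shared type `a` of argument and value is what makes the graph a set; its value is
immaterial. -/
theorem exists_hom {a : ℕ} (R : M → M → Prop) (hR : PDef ![a, a] (fun v => R (v 0) (v 1)))
    (h : ∀ x : A.Elem, ∃! y : B.Elem, R x.1 y.1) :
    ∃ f : A ⟶ B, ∀ x, R x.1 (ev f x).1 := by
  choose f hf hu using h
  refine ⟨⟨f, graphIsSet_iff.2 (PDef.rel (a := a) (b := a)
    (R := fun x y => ∃ h : x ∈' A.carrier, y = (f ⟨x, h⟩).1) ?_ _ _)⟩, hf⟩
  refine PDef.congr (R := fun v => v 0 ∈' A.carrier ∧ v 1 ∈' B.carrier ∧ R (v 0) (v 1))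
    (.and (.mem_const _ _) (.and (.mem_const _ _) hR)) fun v => ?_
  constructor
  · rintro ⟨h1, h2, h3⟩
    exact ⟨h1, congrArg Subtype.val (hu ⟨_, h1⟩ ⟨_, h2⟩ h3)⟩
  · rintro ⟨h1, h2⟩
    rw [h2]
    exact ⟨h1, (f _).2, hf ⟨_, h1⟩⟩

/-- A strongly cantorian codomain lets the value be moved to the type of the argument, so
type-changing functions become morphisms. -/
theorem exists_hom_of_sc_right (hB : StronglyCantorian B.carrier) {a b : ℕ} (R : M → M → Prop)
    (hR : PDef ![a, b] (fun v => R (v 0) (v 1))) (h : ∀ x : A.Elem, ∃! y : B.Elem, R x.1 y.1) :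
    ∃ f : A ⟶ B, ∀ x, R x.1 (ev f x).1 := by
  obtain ⟨f, hf⟩ := exists_hom (A := A) (B := B) (a := a) (fun x y => R x y ∧ y ∈' B.carrier)
    (hB.retype_right (R := fun x y => R x y ∧ y ∈' B.carrier) (PDef.and hR (.mem_const _ _))
      (fun _ _ h => h.2) a)
    (fun x => (existsUnique_congr fun y => by simp [y.2]).1 (h x))
  exact ⟨f, fun x => (hf x).1⟩

/-- The constant morphisms. -/
theorem exists_const (A : SetCat M) (b : B.Elem) : ∃ f : A ⟶ B, ∀ x, ev f x = b := by
  obtain ⟨f, hf⟩ := exists_hom (A := A) (B := B) (a := 0) (fun _ y => y = b.1) (.eq_const _ _)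
    (fun x => ⟨b, rfl, fun y hy => Subtype.ext hy⟩)
  exact ⟨f, fun x => Subtype.ext (hf x)⟩

theorem exists_inclusion {A B : SetCat M} (h : Sub A.carrier B.carrier) :
    ∃ f : A ⟶ B, ∀ x, (ev f x).1 = x.1 := by
  obtain ⟨f, hf⟩ := exists_hom (A := A) (B := B) (a := 0) (fun x y => y = x) (.eq _ _)
    (fun x => ⟨⟨x.1, h _ x.2⟩, rfl, fun y hy => Subtype.ext hy⟩)
  exact ⟨f, hf⟩

/-- Factorisation through an injective morphism. -/
theorem exists_factor {i : B ⟶ C} (hi : Function.Injective (ev i)) (f : A ⟶ C)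
    (h : ∀ x, ∃ y, ev i y = ev f x) : ∃ g : A ⟶ B, g ≫ i = f := by
  -- Morphisms preserve types, so the relation "`f x = i y`" is homogeneous and no cantorian
  -- hypothesis is needed.
  obtain ⟨g, hg⟩ := exists_hom (A := A) (B := B) (a := 0)
    (fun x y => ∃ z, Rel f x z ∧ Rel i y z)
    (.ex 0 (.and (.hom f _ _) (.hom i _ _))) fun x => by
      obtain ⟨y, hy⟩ := h x
      refine ⟨y, ⟨(ev f x).1, by simp, by simp [hy]⟩, fun y' => ?_⟩
      rintro ⟨z, hz, hz'⟩
      rw [rel_iff] at hz hz'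
      exact hi (Subtype.ext (by rw [← hz', hz, hy]))
  refine ⟨g, hom_ext fun x => Subtype.ext ?_⟩
  obtain ⟨z, hz, hz'⟩ := hg x
  rw [rel_iff] at hz hz'
  rw [ev_comp, ← hz', hz]

theorem _root_.NF.StronglyCantorian.of_surjective (hA : StronglyCantorian A.carrier) (f : A ⟶ B)
    (hf : Function.Surjective (ev f)) : StronglyCantorian B.carrier := by
  refine hA.image (a := 0) (b := 0) (R := Rel f) (.hom f _ _) ?_ fun y => ?_
  · rintro x y y' ⟨h, rfl⟩ ⟨h', rfl⟩
    rfl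
  · constructor
    · intro hy
      obtain ⟨x, hx⟩ := hf ⟨y, hy⟩
      exact ⟨x.1, x.2, by simp [hx]⟩
    · rintro ⟨x, hx, _, rfl⟩
      exact (ev f _).2

theorem _root_.NF.StronglyCantorian.of_iso (hA : StronglyCantorian A.carrier) (e : A ≅ B) :
    StronglyCantorian B.carrier :=
  hA.of_surjective e.hom fun y => ⟨ev e.inv y, by rw [← ev_comp, e.inv_hom_id, ev_id]⟩

theorem exists_point (M : Type u) [setLang.Structure M] [Model M] :
    ∃ A : SetCat M, StronglyCantorian A.carrier ∧ Nonempty (Unique A.Elem) := by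
  obtain ⟨y₀, -⟩ := Model.comprehension (M := M) 0 .falsum ⟨fun _ => 0, trivial⟩ Fin.elim0
  obtain ⟨s, hs⟩ := exists_singleton y₀
  exact ⟨⟨s⟩, .of_isSingleton hs,
    ⟨⟨⟨⟨y₀, (hs _).2 rfl⟩⟩, fun y => Subtype.ext ((hs _).1 y.2)⟩⟩⟩

/-- The pairing of two morphisms into strongly cantorian sets. -/
theorem exists_pairing (hA : StronglyCantorian A.carrier) (hB : StronglyCantorian B.carrier)
    (f : C ⟶ A) (g : C ⟶ B) : ∃ h : C ⟶ ⟨cartesian A.carrier B.carrier⟩,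
      ∀ x, IsPair (ev h x).1 (ev f x).1 (ev g x).1 := by
  obtain ⟨h, hh⟩ := exists_hom_of_sc_right (A := C) (B := ⟨cartesian A.carrier B.carrier⟩)
    (hA.cartesian hB) (a := 0) (b := 2) (fun x p => ∃ a b, Rel f x a ∧ Rel g x b ∧ IsPair p a b)
    (.ex 0 (.ex 0 (.and (.hom f _ _) (.and (.hom g _ _) (.pair _ _ _)))))
    fun x => by
      obtain ⟨p, hp⟩ := exists_pair (ev f x).1 (ev g x).1
      refine ⟨⟨p, mem_cartesian.2 ⟨_, _, ⟨(ev f x).2, (ev g x).2⟩, hp⟩⟩,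
        ⟨_, _, (rel_iff f x _).2 rfl, (rel_iff g x _).2 rfl, hp⟩, ?_⟩
      rintro q ⟨a, b, ha, hb, hq⟩
      rw [rel_iff] at ha hb
      subst ha hb
      exact Subtype.ext (hq.unique hp)
  refine ⟨h, fun x => ?_⟩
  obtain ⟨a, b, ha, hb, hp⟩ := hh x
  rw [rel_iff] at ha hb
  rwa [← ha, ← hb]

/-- A pair is two types above its coordinates, so each projection lowers types by two; the strongly
cantorian factors absorb this. -/
theorem exists_fst_snd (hA : StronglyCantorian A.carrier) (hB : StronglyCantorian B.carrier) :
    ∃ (p : (⟨cartesian A.carrier B.carrier⟩ : SetCat M) ⟶ A)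
      (q : (⟨cartesian A.carrier B.carrier⟩ : SetCat M) ⟶ B),
      ∀ x, IsPair x.1 (ev p x).1 (ev q x).1 := by
  have key : ∀ x : Elem ⟨cartesian A.carrier B.carrier⟩, ∃ (a : A.Elem) (b : B.Elem),
      IsPair x.1 a.1 b.1 := fun x => by
    obtain ⟨a, b, ⟨ha, hb⟩, h⟩ := mem_cartesian.1 x.2
    exact ⟨⟨a, ha⟩, ⟨b, hb⟩, h⟩
  obtain ⟨p, hp⟩ := exists_hom_of_sc_right (A := ⟨cartesian A.carrier B.carrier⟩) (B := A) hA
    (a := 2) (b := 0) (fun x a => ∃ b, IsPair x a b) (.ex 0 (.pair _ _ _)) fun x => by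
      obtain ⟨a, b, h⟩ := key x
      exact ⟨a, ⟨b.1, h⟩, fun a' ⟨b', h'⟩ => Subtype.ext (h'.inj h).1⟩
  obtain ⟨q, hq⟩ := exists_hom_of_sc_right (A := ⟨cartesian A.carrier B.carrier⟩) (B := B) hB
    (a := 2) (b := 0) (fun x b => ∃ a, IsPair x a b) (.ex 0 (.pair _ _ _)) fun x => by
      obtain ⟨a, b, h⟩ := key x
      exact ⟨b, ⟨a.1, h⟩, fun b' ⟨a', h'⟩ => Subtype.ext (h'.inj h).2⟩
  refine ⟨p, q, fun x => ?_⟩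
  obtain ⟨b, h1⟩ := hp x
  obtain ⟨a, h2⟩ := hq x
  obtain ⟨rfl, rfl⟩ := h1.inj h2
  exact h1

end SetCat

end Definable
-- Subobjects and power sets, uniformly for all sets and for strongly cantorian sets
section Subobjects

theorem subobject_ext {C : Type*} [Category C] {X : C} {S S' : Subobject X}
    (h : ∀ (Z : C) (f : Z ⟶ X), S.Factors f ↔ S'.Factors f) : S = S' :=
  le_antisymm (Subobject.le_of_factors ((h _ _).1 S.factors_self))
    (Subobject.le_of_factors ((h _ _).2 S'.factors_self))

variable {M : Type u} [setLang.Structure M] [Model M]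

open SetCat

/-- A full subcategory of sets, closed under subsets and containing a point. -/
structure SubsetClosed {C : Type*} [Category C] (F : C ⥤ SetCat M) : Prop where
  full : F.Full
  faithful : F.Faithful
  subset : ∀ (X : C) (S : M), Sub S (F.obj X).carrier → ∃ (Y : C) (i : Y ⟶ X),
    Function.Injective (ev (F.map i)) ∧ ∀ y, (∃ z, ev (F.map i) z = y) ↔ y.1 ∈' S
  point : ∃ Y : C, Nonempty (Unique (F.obj Y).Elem)

theorem subsetClosed_id : SubsetClosed (𝟭 (SetCat M)) where
  full := inferInstance
  faithful := inferInstance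
  subset X S h := by
    obtain ⟨i, hi⟩ := exists_inclusion (A := ⟨S⟩) (B := X) h
    refine ⟨⟨S⟩, i, fun x y hxy => Subtype.ext ?_, fun y => ⟨?_, fun hy => ⟨⟨y.1, hy⟩, ?_⟩⟩⟩
    · have := congrArg Subtype.val hxy
      rwa [Functor.id_map, hi, hi] at this
    · rintro ⟨z, rfl⟩
      rw [Functor.id_map, hi]
      exact z.2
    · exact Subtype.ext (hi _)
  point := (exists_point M).imp fun _ h => h.2

theorem subsetClosed_sc : SubsetClosed (stronglyCantorian M).ι where
  full := inferInstance
  faithful := inferInstance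
  subset X S h := by
    obtain ⟨Y, i, hi⟩ : ∃ (Y : SetCat M) (i : Y ⟶ X.obj), Function.Injective (ev i) ∧
      ∀ y, (∃ z, ev i z = y) ↔ y.1 ∈' S := subsetClosed_id.subset X.obj S h
    refine ⟨⟨Y, ?_⟩, ObjectProperty.homMk i, hi⟩
    obtain ⟨j, hj⟩ := exists_inclusion (A := ⟨S⟩) (B := X.obj) h
    obtain ⟨k, hk⟩ := exists_factor (A := ⟨S⟩) hi.1 j fun x => (hi.2 _).2 (by rw [hj]; exact x.2)
    -- `Y` is known only through its injection onto `S`. It is strongly cantorian as the image of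
    -- `S`, a subset of a strongly cantorian set.
    refine StronglyCantorian.of_surjective (A := ⟨S⟩) (X.property.subset h) k fun y => ?_
    obtain ⟨s, hs⟩ : ∃ s : Elem ⟨S⟩, s.1 = (ev i y).1 := ⟨⟨_, (hi.2 (ev i y)).1 ⟨y, rfl⟩⟩, rfl⟩
    refine ⟨s, hi.1 (Subtype.ext ?_)⟩
    rw [← ev_comp, hk, hj, hs]
  point := by
    obtain ⟨Y, h1, h2⟩ := exists_point M
    exact ⟨⟨Y, h1⟩, h2⟩

variable {C : Type*} [Category C] {F : C ⥤ SetCat M} (hF : SubsetClosed F)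

namespace SubsetClosed

include hF

theorem exists_map_eq {X Y : C} (f : F.obj X ⟶ F.obj Y) : ∃ g : X ⟶ Y, F.map g = f :=
  hF.full.map_surjective f

theorem hom_ext {X Y : C} {f g : X ⟶ Y} (h : ∀ x, ev (F.map f) x = ev (F.map g) x) : f = g :=
  hF.faithful.map_injective (SetCat.hom_ext h)

/-- Elements are morphisms from a one-point object, so statements about morphisms can be tested on
elements. -/
theorem exists_global {X : C} (x : (F.obj X).Elem) :
    ∃ (Y : C) (y : (F.obj Y).Elem) (f : Y ⟶ X), (∀ y', y' = y) ∧ ev (F.map f) y = x := by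
  obtain ⟨Y, ⟨hY⟩⟩ := hF.point
  obtain ⟨f, hf⟩ := exists_const (F.obj Y) x
  obtain ⟨g, rfl⟩ := hF.exists_map_eq f
  exact ⟨Y, default, g, fun y => Unique.eq_default y, hf _⟩

theorem injective_of_mono {X Y : C} (f : X ⟶ Y) [Mono f] :
    Function.Injective (ev (F.map f)) := by
  intro x x' h
  obtain ⟨Z, z, g, hz, hg⟩ := hF.exists_global x
  obtain ⟨k, hk⟩ := exists_const (F.obj Z) x'
  obtain ⟨g', rfl⟩ := hF.exists_map_eq k
  have : g = g' := by
    rw [← cancel_mono f]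
    refine hF.hom_ext fun y => ?_
    rw [hz y]
    simp [hg, hk, h]
  rw [← hg, this, hk]

theorem mono_of_injective {X Y : C} (f : X ⟶ Y) (h : Function.Injective (ev (F.map f))) :
    Mono f where
  right_cancellation g g' e := hF.hom_ext fun x => h <| by
    have := congrArg (fun k => ev (F.map k) x) e
    simpa using this

theorem exists_factor {X Y Z : C} {i : Y ⟶ Z} (hi : Function.Injective (ev (F.map i))) (f : X ⟶ Z)
    (h : ∀ x, ∃ y, ev (F.map i) y = ev (F.map f) x) : ∃ g : X ⟶ Y, g ≫ i = f := by
  obtain ⟨k, hk⟩ := SetCat.exists_factor hi (F.map f) h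
  obtain ⟨g, rfl⟩ := hF.exists_map_eq k
  exact ⟨g, hF.faithful.map_injective (by rw [F.map_comp, hk])⟩

/-- A monomorphism is injective on elements, so a pointwise lift is unique and its graph is
definable. -/
theorem factors_iff {X Z : C} (S : Subobject X) (h : Z ⟶ X) :
    S.Factors h ↔ ∀ z, ∃ y, ev (F.map S.arrow) y = ev (F.map h) z := by
  constructor
  · intro hS z
    refine ⟨ev (F.map (S.factorThru h hS)) z, ?_⟩
    rw [← ev_comp, ← F.map_comp, S.factorThru_arrow]
  · intro hz
    obtain ⟨g, rfl⟩ := hF.exists_factor (hF.injective_of_mono S.arrow) h hz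
    exact Subobject.factors_comp_arrow g

theorem exists_subobject {X : C} {k : ℕ} (R : M → Prop) (hR : PDef ![k] (fun v => R (v 0))) :
    ∃ S : Subobject X, ∀ (Z : C) (h : Z ⟶ X), S.Factors h ↔ ∀ z, R (ev (F.map h) z).1 := by
  obtain ⟨s, hs⟩ := PDef.comprehension (k := k) (R := fun x => x ∈' (F.obj X).carrier ∧ R x)
    (.and (.mem_const _ _) hR)
  obtain ⟨Y, i, hi, hi'⟩ := hF.subset X s fun x hx => ((hs x).1 hx).1
  have := hF.mono_of_injective i hi
  refine ⟨Subobject.mk i, fun Z h => ?_⟩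
  rw [Subobject.mk_factors_iff]
  constructor
  · rintro ⟨g, hg⟩ z
    obtain rfl : (show Z ⟶ Y from g) ≫ i = h := hg
    rw [F.map_comp, ev_comp]
    exact ((hs _).1 ((hi' _).1 ⟨_, rfl⟩)).2
  · intro hz
    obtain ⟨g, hg⟩ := hF.exists_factor hi h fun z => (hi' _).2 ((hs _).2 ⟨(ev (F.map h) z).2, hz z⟩)
    exact ⟨g, hg⟩

/-- The elements of a product are the pairs of elements. -/
theorem existsUnique_of_isLimit {X B : C} {c : BinaryFan X B} (hc : IsLimit c)
    (x : (F.obj X).Elem) (b : (F.obj B).Elem) :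
    ∃! z : (F.obj c.pt).Elem, ev (F.map (BinaryFan.fst c)) z = x ∧
      ev (B := F.obj B) (F.map (BinaryFan.snd c)) z = b := by
  have key : ∀ (p : c.pt ⟶ X) (q : c.pt ⟶ B),
      (∀ (Z : C) (g g' : Z ⟶ c.pt), g ≫ p = g' ≫ p → g ≫ q = g' ≫ q → g = g') →
      (∀ (Z : C) (f : Z ⟶ X) (g : Z ⟶ B), ∃ l, l ≫ p = f ∧ l ≫ q = g) →
      ∃! z : (F.obj c.pt).Elem, ev (F.map p) z = x ∧ ev (F.map q) z = b := by
    intro p q h₁ h₂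
    refine existsUnique_of_exists_of_unique ?_ fun z z' h h' => ?_
    · obtain ⟨Z, z, g, hz, rfl⟩ := hF.exists_global x
      obtain ⟨k, hk⟩ := exists_const (F.obj Z) b
      obtain ⟨g', rfl⟩ := hF.exists_map_eq k
      obtain ⟨l, rfl, rfl⟩ := h₂ Z g g'
      refine ⟨ev (F.map l) z, ?_, ?_⟩
      · rw [← ev_comp, ← F.map_comp]
      · rw [← ev_comp, ← F.map_comp, hk]
    · obtain ⟨Z, w, g, hw, rfl⟩ := hF.exists_global z
      obtain ⟨k, hk⟩ := exists_const (F.obj Z) z'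
      obtain ⟨g', rfl⟩ := hF.exists_map_eq k
      have : g = g' := by
        refine h₁ _ _ _ (hF.hom_ext fun y => ?_) (hF.hom_ext fun y => ?_)
        · rw [hw y, F.map_comp, F.map_comp, ev_comp, ev_comp, hk, h.1, h'.1]
        · rw [hw y, F.map_comp, F.map_comp, ev_comp, ev_comp, hk, h.2, h'.2]
      rw [this, hk]
  refine key _ _ (fun Z g g' h h' => BinaryFan.IsLimit.hom_ext hc h h') fun Z f g => ?_
  obtain ⟨l, h⟩ := BinaryFan.IsLimit.lift' hc f g
  exact ⟨l, h⟩

/-- If the elements of `X` correspond to the members of `A` with types raised by one, and `P` is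
the power set of `A`, then morphisms `B ⟶ P` correspond to subobjects of `X × B`. -/
theorem exists_equiv_subobject {X B K : C} {p : K ⟶ X} {q : K ⟶ B}
    (hpq : ∀ x b, ∃! z : (F.obj K).Elem, ev (F.map p) z = x ∧ ev (F.map q) z = b)
    {A : M} {P : C} (hP : ∀ x, x ∈' (F.obj P).carrier ↔ Sub x A)
    {E : M → M → Prop} (hE : PDef ![1, 0] (fun v => E (v 0) (v 1)))
    (hEA : ∀ t a, E t a → a ∈' A)
    (hE₁ : ∀ t : (F.obj X).Elem, ∃! a, E t.1 a)
    (hE₂ : ∀ a, a ∈' A → ∃! t : (F.obj X).Elem, E t.1 a) :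
    ∃ e : (B ⟶ P) ≃ Subobject K, ∀ (f : B ⟶ P) (Z : C) (h : Z ⟶ K),
      (e f).Factors h ↔ ∀ (z : (F.obj Z).Elem) (a : M), E (ev (F.map (h ≫ p)) z).1 a →
        a ∈' (ev (F.map (h ≫ q ≫ f)) z).1 := by
  have key : ∀ f : B ⟶ P, ∃ S : Subobject K, ∀ (Z : C) (h : Z ⟶ K),
      S.Factors h ↔ ∀ (z : (F.obj Z).Elem) (a : M), E (ev (F.map (h ≫ p)) z).1 a →
        a ∈' (ev (F.map (h ≫ q ≫ f)) z).1 := fun f => by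
    -- Types: `x`, `t`, `b` and `y = f b` all have type `1`, being linked by morphisms, while `a`
    -- has type `0`. This agrees both with `a ∈ y` and with the type difference in `E`.
    obtain ⟨S, hS⟩ := hF.exists_subobject (X := K) (k := 1)
      (fun x => ∀ t a b y, Rel (F.map p) x t → E t a → Rel (F.map q) x b →
        Rel (F.map f) b y → a ∈' y)
      (.all 1 (.all 0 (.all 1 (.all 1 (.imp (.hom _ _ _) (.imp (hE.rel _ _) (.imp (.hom _ _ _)
        (.imp (.hom _ _ _) (.mem _ _)))))))))
    refine ⟨S, fun Z h => (hS Z h).trans (forall_congr' fun z => ?_)⟩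
    simp only [rel_iff, F.map_comp, ev_comp]
    refine ⟨fun H a ha => H _ a _ _ rfl ha rfl ((rel_iff _ _ _).2 rfl), ?_⟩
    rintro H _ a _ y rfl ha rfl hy
    rw [rel_iff] at hy
    exact hy ▸ H a ha
  choose e he using key
  refine ⟨Equiv.ofBijective e ⟨fun f f' hff => hF.hom_ext fun b => Subtype.ext ?_, fun S => ?_⟩, he⟩
  -- The subobject recovers `f`: whether `a` belongs to `f b` is read off from whether the point
  -- `(t, b)`, with `E t a`, factors through it.
  · have hmem : ∀ (f : B ⟶ P) (a : M) (t : (F.obj X).Elem), E t.1 a →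
        ∀ x, ev (F.map p) x = t → ev (F.map q) x = b →
        ∀ (Z : C) (z : (F.obj Z).Elem) (g : Z ⟶ K), (∀ z', z' = z) → ev (F.map g) z = x →
        ((e f).Factors g ↔ a ∈' (ev (F.map f) b).1) := by
      intro f a t hta x hx₁ hx₂ Z z g hz hg
      rw [he]
      constructor
      · intro H
        have := H z a (by rw [F.map_comp, ev_comp, hg, hx₁]; exact hta)
        rwa [F.map_comp, F.map_comp, ev_comp, ev_comp, hg, hx₂] at this
      · intro H z' a' ha'
        rw [F.map_comp, ev_comp, hz z', hg, hx₁] at ha'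
        rw [F.map_comp, F.map_comp, ev_comp, ev_comp, hz z', hg, hx₂,
          (hE₁ t).unique ha' hta]
        exact H
    refine Model.extensionality _ _ fun a => ?_
    have hA : ∀ f : B ⟶ P, a ∈' (ev (F.map f) b).1 → a ∈' A := fun f =>
      (hP _).1 (ev (F.map f) b).2 a
    by_cases ha : a ∈' A
    · obtain ⟨t, ht, -⟩ := hE₂ a ha
      obtain ⟨x, hx₁, hx₂⟩ := (hpq t b).exists
      obtain ⟨Z, z, g, hz, hg⟩ := hF.exists_global x
      rw [← hmem f a t ht x hx₁ hx₂ Z z g hz hg, ← hmem f' a t ht x hx₁ hx₂ Z z g hz hg, hff]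
    · exact ⟨fun h => (ha (hA f h)).elim, fun h => (ha (hA f' h)).elim⟩
  · have hdef : ∀ {n : ℕ} {σ : Fin n → ℕ} (a b : Fin n), σ b = σ a + 1 →
        PDef σ (fun v => ∃ w x t, Rel (F.map S.arrow) w x ∧ Rel (F.map p) x t ∧
          Rel (F.map q) x (v b) ∧ E t (v a)) := fun a b hab =>
      PDef.rel (a := 0) (b := 1) (R := fun a b => ∃ w x t, Rel (F.map S.arrow) w x ∧
        Rel (F.map p) x t ∧ Rel (F.map q) x b ∧ E t a)
        (.ex 1 (.ex 1 (.ex 1 (.and (.hom _ _ _) (.and (.hom _ _ _) (.and (.hom _ _ _)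
          (hE.rel _ _))))))) a b (by omega)
    -- The inverse sends `b` to the set of all `a` whose partner `t` has `(t, b)` in `S`. Since `a`
    -- is one type below `b`, this set has the type of `b`, and the assignment is a morphism.
    obtain ⟨f, hf⟩ := exists_hom (A := F.obj B) (B := F.obj P) (a := 1)
      (fun b y => ∀ a, a ∈' y ↔ ∃ w x t, Rel (F.map S.arrow) w x ∧ Rel (F.map p) x t ∧
        Rel (F.map q) x b ∧ E t a)
      (.all 0 (.iff (.mem _ _) (hdef _ _ rfl))) fun b => by
        obtain ⟨y, hy⟩ := PDef.comprehension (k := 0) (R := fun a => ∃ w x t,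
          Rel (F.map S.arrow) w x ∧ Rel (F.map p) x t ∧ Rel (F.map q) x b.1 ∧ E t a)
          (PDef.inst (R := fun v b => ∃ w x t, Rel (F.map S.arrow) w x ∧ Rel (F.map p) x t ∧
            Rel (F.map q) x b ∧ E t (v 0)) 1 b.1 (hdef _ _ rfl))
        refine ⟨⟨y, (hP _).2 fun a ha => ?_⟩, hy, fun y' hy' => Subtype.ext
          (Model.extensionality _ _ fun a => (hy' a).trans (hy a).symm)⟩
        obtain ⟨w, x, t, -, -, -, h⟩ := (hy a).1 ha
        exact hEA _ _ h
    obtain ⟨f, rfl⟩ := hF.exists_map_eq f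
    refine ⟨f, subobject_ext fun Z h => ?_⟩
    rw [he, hF.factors_iff]
    refine forall_congr' fun z => ?_
    simp only [F.map_comp, ev_comp, hf]
    constructor
    · intro H
      obtain ⟨a, ha, -⟩ := hE₁ (ev (F.map p) (ev (F.map h) z))
      obtain ⟨w, x, t, h1, h2, h3, h4⟩ := H a ha
      obtain ⟨w, rfl, rfl⟩ := (rel_iff' _).1 h1
      rw [rel_iff] at h2 h3
      subst h2
      refine ⟨w, (hpq _ _).unique ⟨?_, Subtype.ext h3.symm⟩ ⟨rfl, rfl⟩⟩
      exact (hE₂ a (hEA _ _ ha)).unique h4 ha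
    · rintro ⟨w, hw⟩ a ha
      exact ⟨w.1, _, _, (rel_iff _ _ _).2 rfl, (rel_iff _ _ _).2 rfl,
        (rel_iff _ _ _).2 (by rw [hw]), by rw [hw]; exact ha⟩

end SubsetClosed

end Subobjects
-- Finite limits, power objects, exponentials and the subobject classifier
section Topos

variable {M : Type u} [setLang.Structure M]

open SetCat

/-- `⟨a, b⟩ ∈ e`. -/
def PairMem (e a b : M) : Prop := ∃ p, p ∈' e ∧ IsPair p a b

theorem PDef.pairMem {n : ℕ} {σ : Fin n → ℕ} (e a b : Fin n)
    (h : σ b = σ a := by first | rfl | (simp; done) | (simp; omega))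
    (h' : σ e = σ a + 3 := by first | rfl | (simp; done) | (simp; omega)) :
    PDef σ (fun v : Fin n → M => PairMem (v e) (v a) (v b)) :=
  .ex (σ a + 2) (.and (.mem _ _) (.pair _ _ _))

theorem PDef.pairMem_const {n : ℕ} {σ : Fin n → ℕ} (i : Fin n) (a b : M) :
    PDef σ (fun v : Fin n → M => PairMem (v i) a b) :=
  PDef.rel' (a := 3) (R := fun e => PairMem e a b)
    (PDef.inst (R := fun v b => PairMem (v 0) a b) 0 b
    (PDef.inst (R := fun v a => PairMem (v 0) a (v 1)) 0 a (.pairMem _ _ _))) i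

theorem PDef.singleton_and_mem (A : M) :
    PDef ![1, 0] (fun v : Fin 2 → M => IsSingleton (v 0) (v 1) ∧ v 1 ∈' A) :=
  .and (.singleton _ _) (.mem_const _ _)

variable [Model M]

theorem SubsetClosed.nonempty_isTerminal {C : Type*} [Category C] {F : C ⥤ SetCat M}
    (hF : SubsetClosed F) {X : C} (hX : Nonempty (Unique (F.obj X).Elem)) :
    Nonempty (IsTerminal X) := by
  obtain ⟨hX⟩ := hX
  have h : ∀ Z : C, Nonempty (Unique (Z ⟶ X)) := fun Z => by
    obtain ⟨f, -⟩ := exists_const (F.obj Z) (default : (F.obj X).Elem)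
    obtain ⟨g, -⟩ := hF.exists_map_eq f
    exact ⟨⟨⟨g⟩, fun g' => hF.hom_ext fun x => Subsingleton.elim _ _⟩⟩
  have := fun Z => (h Z).some
  exact ⟨IsTerminal.ofUnique X⟩

theorem SubsetClosed.hasTerminal {C : Type*} [Category C] {F : C ⥤ SetCat M}
    (hF : SubsetClosed F) : HasTerminal C := by
  obtain ⟨X, hX⟩ := hF.point
  obtain ⟨h⟩ := hF.nonempty_isTerminal hX
  exact h.hasTerminal

theorem SubsetClosed.hasEqualizers {C : Type*} [Category C] {F : C ⥤ SetCat M}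
    (hF : SubsetClosed F) : HasEqualizers C := by
  have : ∀ {X Y : C} {f g : X ⟶ Y}, HasLimit (parallelPair f g) := fun {X Y f g} => by
    obtain ⟨s, hs⟩ := PDef.comprehension (M := M) (k := 0)
      (R := fun x => ∃ y, Rel (F.map f) x y ∧ Rel (F.map g) x y)
      (.ex 0 (.and (.hom _ _ _) (.hom _ _ _)))
    have hs' : ∀ x : (F.obj X).Elem, x.1 ∈' s ↔ ev (F.map f) x = ev (F.map g) x := fun x => by
      rw [hs]
      simp only [rel_iff]
      exact ⟨fun ⟨y, h, h'⟩ => Subtype.ext (h.symm.trans h'), fun h => ⟨_, rfl, by rw [h]⟩⟩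
    obtain ⟨Y, i, hi, hi'⟩ := hF.subset X s fun x hx => by
      obtain ⟨y, ⟨h, -⟩, -⟩ := (hs x).1 hx
      exact h
    have := hF.mono_of_injective i hi
    have w : i ≫ f = i ≫ g := hF.hom_ext fun y => by
      rw [F.map_comp, F.map_comp, ev_comp, ev_comp]
      exact (hs' _).1 ((hi' _).1 ⟨y, rfl⟩)
    have hl : ∀ t : Fork f g, ∃ l : t.pt ⟶ Y, l ≫ i = t.ι := fun t =>
      hF.exists_factor hi t.ι fun x => (hi' _).2 ((hs' _).2 (by
        rw [← ev_comp, ← ev_comp, ← F.map_comp, ← F.map_comp, t.condition]))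
    choose l hl using hl
    exact ⟨⟨⟨Fork.ofι i w, Fork.IsLimit.mk _ l hl fun t m hm => by
      rw [← cancel_mono i, hl]
      exact hm⟩⟩⟩
  exact hasEqualizers_of_hasLimit_parallelPair C

/-- An object with two jointly monic morphisms through which all pairs of morphisms factor is a
product. -/
theorem nonempty_isLimit_binaryFan {C : Type*} [Category C] {A B K : C} (p : K ⟶ A) (q : K ⟶ B)
    (h : ∀ (Z : C) (f g : Z ⟶ K), f ≫ p = g ≫ p → f ≫ q = g ≫ q → f = g)
    (h' : ∀ (Z : C) (f : Z ⟶ A) (g : Z ⟶ B), ∃ l : Z ⟶ K, l ≫ p = f ∧ l ≫ q = g) :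
    Nonempty (IsLimit (BinaryFan.mk p q)) := by
  choose l hl using h'
  exact ⟨BinaryFan.isLimitMk (fun s => l _ s.fst s.snd) (fun s => (hl _ s.fst s.snd).1)
    (fun s => (hl _ s.fst s.snd).2) fun s m hm hm' =>
      h _ _ _ (hm.trans (hl _ s.fst s.snd).1.symm) (hm'.trans (hl _ s.fst s.snd).2.symm)⟩

/-- The universal property holds against every set `Z`, since retyping is needed only in the
codomain. Hence this is a product in the category of all sets. -/
theorem exists_product {A B : SetCat M} (hA : StronglyCantorian A.carrier)
    (hB : StronglyCantorian B.carrier) :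
    ∃ (K : SetCat M) (p : K ⟶ A) (q : K ⟶ B), StronglyCantorian K.carrier ∧
      (∀ (Z : SetCat M) (f g : Z ⟶ K), f ≫ p = g ≫ p → f ≫ q = g ≫ q → f = g) ∧
      ∀ (Z : SetCat M) (f : Z ⟶ A) (g : Z ⟶ B), ∃ l : Z ⟶ K, l ≫ p = f ∧ l ≫ q = g := by
  obtain ⟨p, q, hpq⟩ := exists_fst_snd hA hB
  refine ⟨_, p, q, hA.cartesian hB, fun Z f g h h' => SetCat.hom_ext fun x => Subtype.ext ?_,
    fun Z f g => ?_⟩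
  · have h1 := congrArg (fun k => ev k x) h
    have h2 := congrArg (fun k => ev k x) h'
    simp only [ev_comp] at h1 h2
    have := hpq (ev f x)
    rw [h1, h2] at this
    exact this.unique (hpq _)
  · obtain ⟨l, hl⟩ := exists_pairing hA hB f g
    refine ⟨l, SetCat.hom_ext fun x => Subtype.ext ?_, SetCat.hom_ext fun x => Subtype.ext ?_⟩
    · exact ((hpq _).inj (hl x)).1
    · exact ((hpq _).inj (hl x)).2

theorem hasBinaryProduct_of_sc {A B : SetCat M} (hA : StronglyCantorian A.carrier)
    (hB : StronglyCantorian B.carrier) : HasBinaryProduct A B := by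
  obtain ⟨K, p, q, -, h, h'⟩ := exists_product hA hB
  obtain ⟨hl⟩ := nonempty_isLimit_binaryFan p q h h'
  exact ⟨⟨⟨_, hl⟩⟩⟩

theorem stronglyCantorian_of_isLimit {A B : SetCat M} (hA : StronglyCantorian A.carrier)
    (hB : StronglyCantorian B.carrier) (c : BinaryFan A B) (hc : IsLimit c) :
    StronglyCantorian c.pt.carrier := by
  obtain ⟨K, p, q, hK, h, h'⟩ := exists_product hA hB
  obtain ⟨hl⟩ := nonempty_isLimit_binaryFan p q h h'
  exact hK.of_iso (IsLimit.conePointUniqueUpToIso hl hc)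

theorem stronglyCantorian_of_isTerminal {X : SetCat M} (hX : IsTerminal X) :
    StronglyCantorian X.carrier := by
  obtain ⟨Y, hY, hu⟩ := exists_point M
  obtain ⟨hY'⟩ := subsetClosed_id.nonempty_isTerminal (X := Y) hu
  exact hY.of_iso (hY'.uniqueUpToIso hX)

instance SC.hasFiniteLimits : HasFiniteLimits (SC M) := by
  have h1 := (subsetClosed_sc (M := M)).hasTerminal
  have h2 := (subsetClosed_sc (M := M)).hasEqualizers
  have h3 : ∀ A B : SC M, HasBinaryProduct A B := fun A B => by
    obtain ⟨K, p, q, hK, h, h'⟩ := exists_product A.property B.property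
    obtain ⟨hl⟩ := nonempty_isLimit_binaryFan (A := A) (B := B) (K := ⟨K, hK⟩)
      (ObjectProperty.homMk p) (ObjectProperty.homMk q)
      (fun Z f g h1 h2 => ObjectProperty.hom_ext _ (h _ _ _
        (congrArg (fun k => k.hom) h1) (congrArg (fun k => k.hom) h2)))
      (fun Z f g => by
        obtain ⟨l, h1, h2⟩ := h' _ f.hom g.hom
        exact ⟨ObjectProperty.homMk l, ObjectProperty.hom_ext _ h1, ObjectProperty.hom_ext _ h2⟩)
    exact ⟨⟨⟨_, hl⟩⟩⟩
  have h4 : HasBinaryProducts (SC M) := hasBinaryProducts_of_hasLimit_pair _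
  have h5 : HasFiniteProducts (SC M) := hasFiniteProducts_of_has_binary_and_terminal
  exact hasFiniteLimits_of_hasEqualizers_and_finite_products

/-! ### Power objects -/

theorem SC.existsUnique_prod {A B : SC M} (a : A.obj.Elem) (b : B.obj.Elem) :
    ∃! z : (A ⨯ B : SC M).obj.Elem,
      ev (prod.fst : A ⨯ B ⟶ A).hom z = a ∧ ev (prod.snd : A ⨯ B ⟶ B).hom z = b :=
  subsetClosed_sc.existsUnique_of_isLimit (prodIsProd A B) a b

/-- A family of bijections that is characterised by factorisation represents `Sub(A × -)`. -/
theorem SC.exists_representableBy {A P : SC M}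
    (Q : ∀ (X B : SC M), (X ⟶ A) → (X ⟶ B) → (B ⟶ P) → Prop)
    (hQ : ∀ (X B B' : SC M) (a : X ⟶ A) (b : X ⟶ B) (g : B ⟶ B') (f : B' ⟶ P),
      Q X B a b (g ≫ f) ↔ Q X B' a (b ≫ g) f)
    (h : ∀ B : SC M, ∃ e : (B ⟶ P) ≃ Subobject (A ⨯ B),
      ∀ (f : B ⟶ P) (X : SC M) (h : X ⟶ A ⨯ B),
        (e f).Factors h ↔ Q X B (h ≫ prod.fst) (h ≫ prod.snd) f) :
    ∃ e : (subProd A).RepresentableBy P, ∀ (B : SC M) (f : B ⟶ P) (X : SC M) (h : X ⟶ A ⨯ B),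
      Subobject.Factors (e.homEquiv f : Subobject (A ⨯ B)) h ↔
        Q X B (h ≫ prod.fst) (h ≫ prod.snd) f := by
  choose e he using h
  refine ⟨⟨fun {B} => e B, fun {B B'} g f => ?_⟩, he⟩
  refine subobject_ext fun X (h : X ⟶ A ⨯ B) => ?_
  have h1 := he B (g ≫ f) X h
  have h2 := he B' f X (h ≫ prod.map (𝟙 A) g)
  have h3 := Limits.pullback_factors_iff (prod.map (𝟙 A) g) (e B' f) h
  refine h1.trans ((hQ _ _ _ _ _ _ _).trans (Iff.trans ?_ (h2.symm.trans h3.symm)))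
  rw [Category.assoc, Category.assoc, Category.assoc, prod.map_fst, prod.map_snd, Category.comp_id]

/-- `E` matches elements of `A` with members of `S` one type lower, so `P` is a power object of `A`.
For `TA` it is the singleton relation, for `A` itself it is equality. -/
theorem SC.exists_representableBy_of_rel {A : SC M} {S : M} {P : SC M}
    (hP : ∀ x, x ∈' P.obj.carrier ↔ Sub x S)
    {E : M → M → Prop} (hE : PDef ![1, 0] (fun v => E (v 0) (v 1)))
    (hES : ∀ t a, E t a → a ∈' S)
    (hE₁ : ∀ t : A.obj.Elem, ∃! a, E t.1 a) (hE₂ : ∀ a, a ∈' S → ∃! t : A.obj.Elem, E t.1 a) :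
    ∃ e : (subProd A).RepresentableBy P, ∀ (B : SC M) (f : B ⟶ P) (X : SC M) (h : X ⟶ A ⨯ B),
      Subobject.Factors (e.homEquiv f : Subobject (A ⨯ B)) h ↔
        ∀ (x : X.obj.Elem) (a : M), E (app (h ≫ prod.fst).hom x) a →
          a ∈' app (h ≫ prod.snd ≫ f).hom x := by
  obtain ⟨e, he⟩ := SC.exists_representableBy (A := A) (P := P)
    (fun X B a b f => ∀ (x : X.obj.Elem) (s : M), E (app a.hom x) s → s ∈' app (b ≫ f).hom x)
    (fun X B B' a b g f => by rw [Category.assoc]) fun B => by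
      obtain ⟨e, he⟩ := subsetClosed_sc.exists_equiv_subobject (X := A) (B := B)
        (SC.existsUnique_prod (A := A) (B := B)) hP hE hES hE₁ hE₂
      exact ⟨e, fun f X h => by rw [Category.assoc]; exact he f X h⟩
  exact ⟨e, fun B f X h => by rw [he, Category.assoc]⟩

theorem isSingleton_and_mem_iff {A : SetCat M} (t : A.T.Elem) {a : M} :
    IsSingleton t.1 a ∧ a ∈' A.carrier ↔ IsSingleton t.1 a := by
  refine ⟨And.left, fun h => ⟨h, ?_⟩⟩
  obtain ⟨x, hx, hx'⟩ := mem_singletons.1 t.2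
  rwa [h.inj hx']

theorem existsUnique_isSingleton {A : SetCat M} (t : A.T.Elem) :
    ∃! a, IsSingleton t.1 a ∧ a ∈' A.carrier := by
  obtain ⟨x, hx, hx'⟩ := mem_singletons.1 t.2
  exact ⟨x, ⟨hx', hx⟩, fun _ h => h.1.inj hx'⟩

theorem existsUnique_isSingleton' {A : SetCat M} (a : M) (ha : a ∈' A.carrier) :
    ∃! t : A.T.Elem, IsSingleton t.1 a ∧ a ∈' A.carrier := by
  obtain ⟨s, hs⟩ := exists_singleton a
  exact ⟨⟨s, mem_singletons.2 ⟨a, ha, hs⟩⟩, ⟨hs, ha⟩, fun t h => Subtype.ext (h.1.unique hs)⟩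

/-- The power set of a strongly cantorian set is a power object. -/
theorem SC.exists_representableBy_of_mem (A : SC M) {P : SC M}
    (hP : ∀ x, x ∈' P.obj.carrier ↔ Sub x A.obj.carrier) :
    ∃ e : (subProd A).RepresentableBy P, ∀ (B : SC M) (f : B ⟶ P) (X : SC M) (h : X ⟶ A ⨯ B),
      Subobject.Factors (e.homEquiv f : Subobject (A ⨯ B)) h ↔
        ∀ x : X.obj.Elem, app (h ≫ prod.fst).hom x ∈' app (h ≫ prod.snd ≫ f).hom x := by
  obtain ⟨e, he⟩ := SC.exists_representableBy_of_rel hP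
    -- Here `A` being strongly cantorian is used: equality itself is definable with its sides at
    -- types `1` and `0`.
    (E := fun t a => t ∈' A.obj.carrier ∧ a = t) (A.property.pdef _ _) (fun t a h => h.2 ▸ h.1)
    (fun t => ⟨t.1, ⟨t.2, rfl⟩, fun _ h => h.2⟩)
    (fun a ha => ⟨⟨a, ha⟩, ⟨ha, rfl⟩, fun t h => Subtype.ext h.2.symm⟩)
  refine ⟨e, fun B f X h => (he B f X h).trans (forall_congr' fun x => ?_)⟩
  refine ⟨fun H => H _ ⟨(ev (h ≫ prod.fst).hom x).2, rfl⟩, ?_⟩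
  rintro H _ ⟨-, rfl⟩
  exact H

/-! ### Exponentials -/

/-- The set of functions from `A` to `B`. -/
theorem exists_functions {A B : SetCat M} (hA : StronglyCantorian A.carrier)
    (hB : StronglyCantorian B.carrier) :
    ∃ E : SetCat M, StronglyCantorian E.carrier ∧ ∀ e, e ∈' E.carrier ↔
      Sub e (cartesian A.carrier B.carrier) ∧
        ∀ a : A.Elem, ∃ b, PairMem e a.1 b ∧ ∀ b', PairMem e a.1 b' → b' = b := by
  obtain ⟨s, hs⟩ := PDef.comprehension (M := M) (k := 3) (R := fun e =>
    Sub e (cartesian A.carrier B.carrier) ∧ ∀ a, a ∈' A.carrier →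
      ∃ b, PairMem e a b ∧ ∀ b', PairMem e a b' → b' = b)
    (.and (.sub_const _ _) (.all 0 (.imp (.mem_const _ _) (.ex 0 (.and (.pairMem _ _ _)
      (.all 0 (.imp (.pairMem _ _ _) (.eq _ _))))))))
  refine ⟨⟨s⟩, (hA.cartesian hB).power.subset fun x hx => mem_power.2 ((hs x).1 hx).1, ?_⟩
  intro e
  rw [hs]
  exact and_congr_right fun _ => ⟨fun h a => h a.1 a.2, fun h a ha => h ⟨a, ha⟩⟩

theorem pairMem_mem {A B e a b : M} (he : Sub e (cartesian A B)) (h : PairMem e a b) :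
    a ∈' A ∧ b ∈' B := by
  obtain ⟨p, hp, hp'⟩ := h
  obtain ⟨a', b', h, h'⟩ := mem_cartesian.1 (he p hp)
  obtain ⟨rfl, rfl⟩ := hp'.inj h'
  exact h

theorem pairMem_ext {A B e e' : M} (he : Sub e (cartesian A B)) (he' : Sub e' (cartesian A B))
    (h : ∀ a b, PairMem e a b ↔ PairMem e' a b) : e = e' := by
  have key : ∀ {e e' : M}, Sub e (cartesian A B) → (∀ a b, PairMem e a b → PairMem e' a b) →
      ∀ p, p ∈' e → p ∈' e' := by
    intro e e' he h p hp
    obtain ⟨a, b, -, hab⟩ := mem_cartesian.1 (he p hp)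
    obtain ⟨q, hq, hq'⟩ := h a b ⟨p, hp, hab⟩
    rwa [hab.unique hq']
  exact Model.extensionality _ _ fun p =>
    ⟨key he (fun a b => (h a b).1) p, key he' (fun a b => (h a b).2) p⟩

/-- The functor `A × -` on strongly cantorian sets has a right adjoint. -/
theorem SC.isLeftAdjoint_prod (A : SC M) : (prod.functor.obj A).IsLeftAdjoint := by
  have hpair : ∀ X : SC M, ∃ (p : (A ⨯ X : SC M).obj ⟶ A.obj) (q : (A ⨯ X : SC M).obj ⟶ X.obj),
      p = (prod.fst : A ⨯ X ⟶ A).hom ∧ q = (prod.snd : A ⨯ X ⟶ X).hom ∧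
      ∀ a x, ∃! z, ev p z = a ∧ ev q z = x := fun X =>
    ⟨_, _, rfl, rfl, fun a x => SC.existsUnique_prod a x⟩
  -- `A ⨯ X` is an arbitrarily chosen product, whose elements need not be ordered pairs; they are
  -- accessible only through the projections.
  choose p q hp hq hpq using hpair
  have hE : ∀ B : SC M, ∃ (E : SC M), ∀ e, e ∈' E.obj.carrier ↔
      Sub e (cartesian A.obj.carrier B.obj.carrier) ∧
        ∀ a : A.obj.Elem, ∃ b, PairMem e a.1 b ∧ ∀ b', PairMem e a.1 b' → b' = b := fun B => by
    obtain ⟨E, hE, h⟩ := exists_functions A.property B.property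
    exact ⟨⟨E, hE⟩, h⟩
  choose E hE using hE
  have hev : ∀ B : SC M, ∃ f : A ⨯ E B ⟶ B,
      ∀ z, PairMem (ev (q (E B)) z).1 (ev (p (E B)) z).1 (ev f.hom z).1 := fun B => by
    -- A function, as a set of pairs, is three types above its arguments. The second projection
    -- yields it at type `0`, so `e'` is its copy at type `3`, available because the set of
    -- functions is strongly cantorian.
    obtain ⟨f, hf⟩ := exists_hom (A := (A ⨯ E B : SC M).obj) (B := B.obj) (a := 0)
      (fun z b => ∃ a e e', Rel (p (E B)) z a ∧ Rel (q (E B)) z e ∧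
        (e ∈' (E B).obj.carrier ∧ e' = e) ∧ PairMem e' a b)
      (.ex 0 (.ex 0 (.ex 3 (.and (.hom _ _ _) (.and (.hom _ _ _)
        (.and ((E B).property.pdef _ _) (.pairMem _ _ _))))))) fun z => by
        obtain ⟨h1, h2⟩ := (hE B _).1 (ev (q (E B)) z).2
        obtain ⟨b, hb, hu⟩ := h2 (ev (p (E B)) z)
        refine ⟨⟨b, (pairMem_mem h1 hb).2⟩, ⟨_, _, _, (rel_iff _ _ _).2 rfl, (rel_iff _ _ _).2 rfl,
          ⟨(ev (q (E B)) z).2, rfl⟩, hb⟩, ?_⟩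
        rintro b' ⟨a, e, e', ha, he, ⟨-, rfl⟩, h⟩
        rw [rel_iff] at ha he
        subst ha he
        exact Subtype.ext (hu _ h)
    refine ⟨ObjectProperty.homMk f, fun z => ?_⟩
    obtain ⟨a, e, e', ha, he, ⟨-, rfl⟩, h⟩ := hf z
    rw [rel_iff] at ha he
    rwa [ha, he] at h
  choose apply happly using hev
  have hfun : ∀ (X B : SC M) (k : X ⟶ E B) (g : A ⨯ X ⟶ B),
      prod.map (𝟙 A) k ≫ apply B = g ↔
        ∀ z, PairMem (ev k.hom (ev (q X) z)).1 (ev (p X) z).1 (ev g.hom z).1 := by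
    intro X B k g
    have h : ∀ z, PairMem (ev k.hom (ev (q X) z)).1 (ev (p X) z).1
        (ev (prod.map (𝟙 A) k ≫ apply B).hom z).1 := by
      intro z
      have h1 : (prod.map (𝟙 A) k).hom ≫ p (E B) = p X := by
        rw [hp, hp]
        exact congrArg (fun k => k.hom) ((prod.map_fst (𝟙 A) k).trans (Category.comp_id _))
      have h2 : (prod.map (𝟙 A) k).hom ≫ q (E B) = q X ≫ k.hom := by
        rw [hq, hq]
        exact congrArg (fun k => k.hom) (prod.map_snd (𝟙 A) k)
      have := happly B (ev (prod.map (𝟙 A) k).hom z)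
      rwa [← ev_comp, ← ev_comp, h1, h2] at this
    constructor
    · rintro rfl
      exact h
    · intro h'
      refine subsetClosed_sc.hom_ext fun z => Subtype.ext ?_
      obtain ⟨b, -, hb⟩ := ((hE B _).1 (ev k.hom (ev (q X) z)).2).2 (ev (p X) z)
      exact (hb _ (h z)).trans (hb _ (h' z)).symm
  have hbij : ∀ X B : SC M, Function.Bijective
      (fun k : X ⟶ E B => (prod.map (𝟙 A) k ≫ apply B : A ⨯ X ⟶ B)) := by
    intro X B
    constructor
    · intro k k' hkk
      have h := (hfun X B k _).1 rfl
      have h' := (hfun X B k' _).1 hkk.symm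
      refine subsetClosed_sc.hom_ext fun x => Subtype.ext ?_
      change (ev k.hom x).1 = (ev k'.hom x).1
      have h1 := (hE B _).1 (ev k.hom x).2
      have h2 := (hE B _).1 (ev k'.hom x).2
      refine pairMem_ext h1.1 h2.1 fun a b => ?_
      by_cases ha : a ∈' A.obj.carrier
      · obtain ⟨z, hz, rfl⟩ := (hpq X ⟨a, ha⟩ x).exists
        obtain ⟨b₁, -, hb₁⟩ := h1.2 ⟨a, ha⟩
        obtain ⟨b₂, -, hb₂⟩ := h2.2 ⟨a, ha⟩
        have h3 := h z
        have h4 := h' z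
        rw [hz] at h3 h4
        constructor
        · intro hb
          rw [hb₁ b hb, ← hb₁ _ h3]
          exact h4
        · intro hb
          rw [hb₂ b hb, ← hb₂ _ h4]
          exact h3
      · exact ⟨fun hb => (ha (pairMem_mem h1.1 hb).1).elim,
          fun hb => (ha (pairMem_mem h2.1 hb).1).elim⟩
    · intro g
      have hR : PDef ![0, 0, 0] (fun v : Fin 3 → M =>
          ∃ z, Rel (p X) z (v 0) ∧ Rel (q X) z (v 2) ∧ Rel g.hom z (v 1)) :=
        .ex 0 (.and (.hom _ _ _) (.and (.hom _ _ _) (.hom _ _ _)))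
      have hval : ∀ z b, (∃ z', Rel (p X) z' (ev (p X) z).1 ∧ Rel (q X) z' (ev (q X) z).1 ∧
          Rel g.hom z' b) ↔ b = (ev g.hom z).1 := by
        intro z b
        constructor
        · rintro ⟨z', h1, h2, h3⟩
          obtain ⟨z', rfl, h4⟩ := (rel_iff' _).1 h1
          rw [rel_iff] at h2 h3
          obtain rfl := (hpq X _ _).unique ⟨Subtype.ext h4, Subtype.ext h2.symm⟩ ⟨rfl, rfl⟩
          exact h3
        · rintro rfl
          exact ⟨z.1, (rel_iff _ _ _).2 rfl, (rel_iff _ _ _).2 rfl, (rel_iff _ _ _).2 rfl⟩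
      have hmem : ∀ x a b, (∃ z, Rel (p X) z a ∧ Rel (q X) z x ∧ Rel g.hom z b) →
          a ∈' A.obj.carrier ∧ b ∈' B.obj.carrier := by
        rintro x a b ⟨z, ⟨h, rfl⟩, -, ⟨h', rfl⟩⟩
        exact ⟨(ev (p X) _).2, (ev g.hom _).2⟩
      -- The transpose of `g` sends `x` to the graph of `a ↦ g (a, x)`, three types higher; the set
      -- of functions is strongly cantorian and absorbs the difference.
      obtain ⟨k, hk⟩ := exists_hom_of_sc_right (A := X.obj) (B := (E B).obj) (E B).property
        (a := 0) (b := 3)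
        (fun x e => ∀ a b, PairMem e a b ↔ ∃ z, Rel (p X) z a ∧ Rel (q X) z x ∧ Rel g.hom z b)
        (.all 0 (.all 0 (.iff (.pairMem _ _ _)
          (hR.rename ![2, 3, 0] 0 0 (by intro i; fin_cases i <;> rfl))))) fun x => by
          obtain ⟨e, he⟩ := PDef.comprehension (M := M) (k := 2) (R := fun r => ∃ a b,
            (∃ z, Rel (p X) z a ∧ Rel (q X) z x.1 ∧ Rel g.hom z b) ∧ IsPair r a b)
            (PDef.inst (R := fun v x => ∃ a b,
            (∃ z, Rel (p X) z a ∧ Rel (q X) z x ∧ Rel g.hom z b) ∧ IsPair (v 0) a b) 0 x.1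
            (.ex 0 (.ex 0 (.and (.ex 0 (.and (.hom _ _ _) (.and (.hom _ _ _) (.hom _ _ _))))
              (.pair _ _ _)))))
          have he' : ∀ a b, PairMem e a b ↔
              ∃ z, Rel (p X) z a ∧ Rel (q X) z x.1 ∧ Rel g.hom z b := by
            intro a b
            constructor
            · rintro ⟨r, hr, hr'⟩
              obtain ⟨a', b', h, h'⟩ := (he r).1 hr
              obtain ⟨rfl, rfl⟩ := hr'.inj h'
              exact h
            · intro h
              obtain ⟨r, hr⟩ := exists_pair a b
              exact ⟨r, (he r).2 ⟨a, b, h, hr⟩, hr⟩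
          have hsub : Sub e (cartesian A.obj.carrier B.obj.carrier) := fun r hr => by
            obtain ⟨a, b, h, h'⟩ := (he r).1 hr
            exact mem_cartesian.2 ⟨a, b, hmem _ _ _ h, h'⟩
          refine ⟨⟨e, (hE B e).2 ⟨hsub, fun a => ?_⟩⟩, he', fun e' h => Subtype.ext ?_⟩
          · obtain ⟨z, rfl, rfl⟩ := (hpq X a x).exists
            simp only [he', hval]
            exact ⟨_, rfl, fun _ h => h⟩
          · exact pairMem_ext ((hE B _).1 e'.2).1 hsub fun a b => (h a b).trans (he' a b).symm
      refine ⟨ObjectProperty.homMk k, (hfun _ _ _ _).2 fun z => ?_⟩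
      exact (hk _ _ _).2 ((hval _ _).2 rfl)
  let e : ∀ X B : SC M, ((prod.functor.obj A).obj X ⟶ B) ≃ (X ⟶ E B) := fun X B =>
    (Equiv.ofBijective _ (hbij X B)).symm
  refine (Adjunction.adjunctionOfEquivRight (F := prod.functor.obj A) (G_obj := E) e
    fun X' X B f g => ?_).isLeftAdjoint
  obtain ⟨k, rfl⟩ := (hbij X B).2 g
  have h : e X B (prod.map (𝟙 A) k ≫ apply B) = k :=
    (Equiv.ofBijective _ (hbij X B)).symm_apply_apply k
  have h' : e X' B (prod.map (𝟙 A) (f ≫ k) ≫ apply B) = f ≫ k :=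
    (Equiv.ofBijective _ (hbij X' B)).symm_apply_apply _
  have hm : prod.map (𝟙 A) (f ≫ k) ≫ apply B =
      prod.map (𝟙 A) f ≫ prod.map (𝟙 A) k ≫ apply B := by
    rw [prod.map_id_comp, Category.assoc]
  exact (congrArg (e X' B) hm.symm).trans <| h'.trans (congrArg (f ≫ ·) h.symm)

theorem SC.isElementaryTopos : IsElementaryTopos (SC M) where
  hasFiniteLimits := inferInstance
  cartesianClosed A := SC.isLeftAdjoint_prod A
  hasSubobjectClassifier := by
    rw [hasSubobjectClassifier_iff_isRepresentable]
    obtain ⟨e, -⟩ := SC.exists_representableBy_of_mem (⊤_ (SC M))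
      (P := ⟨(⊤_ (SC M)).obj.P, StronglyCantorian.power (⊤_ (SC M)).property⟩)
      (fun _ => mem_power)
    -- Since `1 × X ≅ X`, representing `Sub(1 × -)` represents `Sub`, which is what a subobject
    -- classifier amounts to.
    have i : 𝟭 (SC M) ≅ prod.functor.obj (⊤_ (SC M)) :=
      (NatIso.ofComponents (fun X => prod.leftUnitor X)
        (fun f => prod.map_snd _ _)).symm
    exact (e.ofIso (Functor.isoWhiskerRight (NatIso.op i)
      (Subobject.presheaf (SC M)))).isRepresentable

end Topos
-- Frege numerals, the Axiom of Counting and the natural numbers object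
section Naturals

variable {M : Type u} [setLang.Structure M]

theorem AxiomOfCounting.exists_mem (h : AxiomOfCounting M) : ∀ n : M, IsNat n → ∃ x, x ∈' n :=
  fun n hn => (h n hn).imp fun _ hs => hs.2

variable [Model M]

open SetCat

theorem exists_zero (M : Type u) [setLang.Structure M] [Model M] : ∃ z : M, IsZero z :=
  PDef.comprehension (k := 1) (R := fun x => ∀ w, ¬ w ∈' x) (.all 0 (.not (.mem _ _)))

theorem exists_succ (m : M) : ∃ n : M, IsSucc m n :=
  PDef.comprehension (k := 1)
    (R := fun x => ∃ y a, y ∈' m ∧ ¬ a ∈' y ∧ ∀ w, w ∈' x ↔ w ∈' y ∨ w = a)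
    (.ex 1 (.ex 0 (.and (.mem_const _ _) (.and (.not (.mem _ _))
      (.all 0 (.iff (.mem _ _) (.or (.mem _ _) (.eq _ _))))))))

variable (M) in
/-- The number zero. -/
noncomputable def zero : M := (exists_zero M).choose

/-- The successor of a number. -/
noncomputable def succ (m : M) : M := (exists_succ m).choose

theorem mem_zero {x : M} : x ∈' zero M ↔ ∀ w, ¬ w ∈' x := (exists_zero M).choose_spec x

theorem mem_succ {m x : M} :
    x ∈' succ m ↔ ∃ y a, y ∈' m ∧ ¬ a ∈' y ∧ ∀ w, w ∈' x ↔ w ∈' y ∨ w = a :=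
  (exists_succ m).choose_spec x

theorem isZero_iff {z : M} : IsZero z ↔ z = zero M :=
  ⟨fun h => Model.extensionality _ _ fun x => (h x).trans mem_zero.symm,
    fun h => h ▸ fun _ => mem_zero⟩

theorem isSucc_iff {m n : M} : IsSucc m n ↔ n = succ m :=
  ⟨fun h => Model.extensionality _ _ fun x => (h x).trans mem_succ.symm,
    fun h => h ▸ fun _ => mem_succ⟩

theorem PDef.succ {n : ℕ} {σ : Fin n → ℕ} (i j : Fin n)
    (h : σ i = σ j := by first | rfl | (simp; done) | (simp; omega)) :
    PDef σ (fun v : Fin n → M => v j = succ (v i)) := by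
  refine PDef.rel (a := 2) (b := 2) (R := fun m n => n = NF.succ m) ?_ i j (by omega)
  refine PDef.congr (R := fun v => ∀ x, x ∈' v 1 ↔
    ∃ y a, y ∈' v 0 ∧ ¬ a ∈' y ∧ ∀ w, w ∈' x ↔ w ∈' y ∨ w = a)
    (.all 1 (.iff (.mem _ _) (.ex 1 (.ex 0 (.and (.mem _ _) (.and (.not (.mem _ _))
      (.all 0 (.iff (.mem _ _) (.or (.mem _ _) (.eq _ _)))))))))) fun v => isSucc_iff

theorem succ_ne_zero (m : M) : succ m ≠ zero M := by
  intro h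
  obtain ⟨e, he⟩ := PDef.comprehension (M := M) (k := 0) (R := fun _ => False) (.const False)
  have h1 : e ∈' succ m := h ▸ mem_zero.2 fun w => (he w).1
  obtain ⟨y, a, -, -, hw⟩ := mem_succ.1 h1
  exact (he a).1 ((hw a).2 (Or.inr rfl))

theorem isNat_iff {n : M} :
    IsNat n ↔ ∀ I : M, zero M ∈' I → (∀ m, m ∈' I → succ m ∈' I) → n ∈' I := by
  simp [IsNat, isZero_iff, isSucc_iff]

theorem isNat_zero : IsNat (zero M) := isNat_iff.2 fun _ h _ => h

theorem IsNat.isNat_succ {n : M} (h : IsNat n) : IsNat (succ n) :=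
  isNat_iff.2 fun I h0 hs => hs _ (isNat_iff.1 h I h0 hs)

theorem exists_nat (M : Type u) [setLang.Structure M] [Model M] :
    ∃ N : M, ∀ n, n ∈' N ↔ IsNat n := by
  simp only [isNat_iff]
  refine PDef.comprehension (k := 0) (.all 1 (.imp (.const_mem _ _) (.imp (.all 0
    (.imp (.mem _ _) ?_)) (.mem _ _))))
  refine PDef.congr (R := fun v => ∃ m', m' = NF.succ (v 2) ∧ m' ∈' v 1)
    (.ex 0 (.and (.succ _ _) (.mem _ _))) fun v => ?_
  simp only [exists_eq_left]
  rfl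

variable (M) in
/-- The set of natural numbers. -/
noncomputable def natSet : M := (exists_nat M).choose

theorem mem_natSet {n : M} : n ∈' natSet M ↔ IsNat n := (exists_nat M).choose_spec n

theorem PDef.isNat {n : ℕ} {σ : Fin n → ℕ} (i : Fin n) :
    PDef σ (fun v : Fin n → M => IsNat (v i)) :=
  (PDef.mem_const i (natSet M)).congr fun _ => mem_natSet

/-- Induction for stratified properties. -/
theorem IsNat.induction {k : ℕ} {P : M → Prop} (hP : PDef ![k] (fun v => P (v 0)))
    (h0 : P (zero M)) (hs : ∀ n, IsNat n → P n → P (succ n)) {n : M} (hn : IsNat n) : P n := by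
  obtain ⟨I, hI⟩ := PDef.comprehension (k := k) (R := fun n => IsNat n ∧ P n) (.and (.isNat _) hP)
  refine ((hI _).1 (isNat_iff.1 hn I ((hI _).2 ⟨isNat_zero, h0⟩) fun m hm => ?_)).2
  obtain ⟨h1, h2⟩ := (hI _).1 hm
  exact (hI _).2 ⟨h1.isNat_succ, hs _ h1 h2⟩

theorem IsNat.eq_zero_or_succ {n : M} (hn : IsNat n) : n = zero M ∨ ∃ k, IsNat k ∧ n = succ k :=
  hn.induction (k := 0) (P := fun n => n = zero M ∨ ∃ k, IsNat k ∧ n = NF.succ k)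
    (.or (.eq_const _ _) (.ex 0 (.and (.isNat _) (.succ _ _)))) (Or.inl rfl)
    fun k hk _ => Or.inr ⟨k, hk, rfl⟩

/-- A numeral is closed under exchanging one member of a set for an outsider. In the induction step
either the last element added is exchanged, or the exchange happens in the smaller set. -/
theorem IsNat.swap_mem {n : M} (hn : IsNat n) : ∀ y a a' y', y ∈' n → a' ∈' y → ¬ a ∈' y →
    (∀ w, w ∈' y' ↔ (w ∈' y ∧ w ≠ a') ∨ w = a) → y' ∈' n := by
  refine hn.induction (k := 2) (P := fun n => ∀ y a a' y', y ∈' n → a' ∈' y → ¬ a ∈' y →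
    (∀ w, w ∈' y' ↔ (w ∈' y ∧ w ≠ a') ∨ w = a) → y' ∈' n)
    (.all 1 (.all 0 (.all 0 (.all 1 (.imp (.mem _ _) (.imp (.mem _ _) (.imp (.not (.mem _ _))
      (.imp (.all 0 (.iff (.mem _ _) (.or (.and (.mem _ _) (.not (.eq _ _))) (.eq _ _))))
        (.mem _ _))))))))) ?_ ?_
  · intro y a a' y' hy ha'
    exact (mem_zero.1 hy _ ha').elim
  · intro m hm ih y a a' y' hy ha' ha hy'
    obtain ⟨u, b, hu, hb, hw⟩ := mem_succ.1 hy
    rw [hw, not_or] at ha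
    rcases eq_or_ne a' b with rfl | hab
    · refine mem_succ.2 ⟨u, a, hu, ha.1, fun w => ?_⟩
      rw [hy', hw]
      refine or_congr_left ⟨fun h => h.1.resolve_right h.2, fun h => ⟨Or.inl h, ?_⟩⟩
      rintro rfl
      exact hb h
    · have ha'u : a' ∈' u := ((hw _).1 ha').resolve_right hab
      obtain ⟨u', hu'⟩ := PDef.comprehension (M := M) (k := 0)
        (R := fun w => (w ∈' u ∧ w ≠ a') ∨ w = a)
        (.or (.and (.mem_const _ _) (.not (.eq_const _ _))) (.eq_const _ _))
      refine mem_succ.2 ⟨u', b, ih u a a' u' hu ha'u ha.1 hu', ?_, fun w => ?_⟩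
      · rw [hu']
        rintro (h | h)
        · exact hb h.1
        · exact ha.2 h.symm
      · rw [hy', hw, hu']
        constructor
        · rintro (⟨h | h, h'⟩ | h)
          · exact Or.inl (Or.inl ⟨h, h'⟩)
          · exact Or.inr h
          · exact Or.inl (Or.inr h)
        · rintro ((⟨h, h'⟩ | h) | rfl)
          · exact Or.inl ⟨Or.inl h, h'⟩
          · exact Or.inr h
          · exact Or.inl ⟨Or.inr rfl, hab.symm⟩

/-- Two ways of removing one element from `z` differ by an exchange, so the size of the remainder
does not depend on the element removed. -/
theorem IsNat.remove_mem {m z y a y' a' : M} (hm : IsNat m) (hy : y ∈' m) (ha : ¬ a ∈' y)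
    (hz : ∀ w, w ∈' z ↔ w ∈' y ∨ w = a) (ha' : ¬ a' ∈' y')
    (hz' : ∀ w, w ∈' z ↔ w ∈' y' ∨ w = a') : y' ∈' m := by
  have h : ∀ w, w ∈' y' ↔ (w ∈' y ∨ w = a) ∧ w ≠ a' := fun w => by
    rw [← hz, hz']
    constructor
    · intro hw
      refine ⟨Or.inl hw, ?_⟩
      rintro rfl
      exact ha' hw
    · exact fun h => h.1.resolve_right h.2
  rcases eq_or_ne a a' with rfl | haa
  · have : y' = y := Model.extensionality _ _ fun w => by
      rw [h]
      constructor
      · exact fun h => h.1.resolve_right h.2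
      · intro hw
        refine ⟨Or.inl hw, ?_⟩
        rintro rfl
        exact ha hw
    rwa [this]
  · refine hm.swap_mem y a a' y' hy ?_ ha fun w => (h w).trans ?_
    · exact ((hz a').1 ((hz' a').2 (Or.inr rfl))).resolve_right haa.symm
    · constructor
      · rintro ⟨h | h, h'⟩
        · exact Or.inl ⟨h, h'⟩
        · exact Or.inr h
      · rintro (h | rfl)
        · exact ⟨Or.inl h.1, h.2⟩
        · exact ⟨Or.inr rfl, haa⟩

/-- Distinct natural numbers are disjoint. -/
theorem IsNat.eq_of_mem {m n x : M} (hm : IsNat m) (hn : IsNat n) (h : x ∈' m) (h' : x ∈' n) :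
    m = n := by
  refine hm.induction (k := 2) (P := fun m => ∀ n x, IsNat n → x ∈' m → x ∈' n → m = n)
    (.all 2 (.all 1 (.imp (.isNat _) (.imp (.mem _ _) (.imp (.mem _ _) (.eq _ _)))))) ?_ ?_
    n x hn h h'
  · intro n x hn hx hx'
    rcases hn.eq_zero_or_succ with rfl | ⟨k, hk, rfl⟩
    · rfl
    · obtain ⟨y, a, -, -, hw⟩ := mem_succ.1 hx'
      exact (mem_zero.1 hx a ((hw a).2 (Or.inr rfl))).elim
  · intro m hm ih n x hn hx hx'
    obtain ⟨y, a, hy, ha, hw⟩ := mem_succ.1 hx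
    rcases hn.eq_zero_or_succ with rfl | ⟨k, hk, rfl⟩
    · exact (mem_zero.1 hx' a ((hw a).2 (Or.inr rfl))).elim
    · obtain ⟨y', a', hy', ha', hw'⟩ := mem_succ.1 hx'
      rw [ih k y' hk (hm.remove_mem hy ha hw ha' hw') hy']

/-- A member of the common successor, with one element removed, lies in both `m` and `n`.
Nonemptiness is essential: an empty numeral would be its own successor. -/
theorem succ_inj (hne : ∀ n : M, IsNat n → ∃ x, x ∈' n) {m n : M} (hm : IsNat m) (hn : IsNat n)
    (h : succ m = succ n) : m = n := by
  obtain ⟨x, hx⟩ := hne _ hm.isNat_succ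
  obtain ⟨y, a, hy, ha, hw⟩ := mem_succ.1 hx
  obtain ⟨y', a', hy', ha', hw'⟩ := mem_succ.1 (h ▸ hx)
  exact hm.eq_of_mem hn (hm.remove_mem hy ha hw ha' hw') hy'

/-! ### The order of the natural numbers -/

/-- `n` belongs to every set that contains `m` and is closed under successors. -/
def Le (m n : M) : Prop := ∀ I : M, m ∈' I → (∀ k, k ∈' I → succ k ∈' I) → n ∈' I

theorem Le.refl (m : M) : Le m m := fun _ h _ => h

theorem Le.trans {l m n : M} (h : Le l m) (h' : Le m n) : Le l n :=
  fun I hl hI => h' I (h I hl hI) hI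

theorem Le.le_succ {m n : M} (h : Le m n) : Le m (succ n) := fun I hm hI => hI _ (h I hm hI)

theorem PDef.le {n : ℕ} {σ : Fin n → ℕ} (i j : Fin n)
    (h : σ i = σ j := by first | rfl | (simp; done) | (simp; omega)) :
    PDef σ (fun v : Fin n → M => Le (v i) (v j)) := by
  refine PDef.all (σ i + 1) (.imp (.mem _ _) (.imp (.all (σ i) (.imp (.mem _ _) ?_)) (.mem _ _)))
  refine PDef.congr (R := fun v => ∃ m', m' = NF.succ (v (Fin.last _)) ∧
    m' ∈' v (Fin.last n).castSucc)
    (.ex (σ i) (.and (.succ _ _) (.mem _ _))) fun v => ?_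
  simp only [exists_eq_left]

theorem Le.induction {k : ℕ} {P : M → Prop} (hP : PDef ![k] (fun v => P (v 0))) {m n : M}
    (h : Le m n) (hm : P m) (hs : ∀ n, P n → P (NF.succ n)) : P n := by
  obtain ⟨I, hI⟩ := PDef.comprehension hP
  exact (hI _).1 (h I ((hI _).2 hm) fun k hk => (hI _).2 (hs _ ((hI _).1 hk)))

theorem PDef.const_le {n : ℕ} {σ : Fin n → ℕ} (m : M) (j : Fin n) :
    PDef σ (fun v : Fin n → M => Le m (v j)) :=
  PDef.inst (R := fun v m => Le m (v j)) (σ j) m (.le _ _)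

theorem Le.eq_or_succ_le {m n : M} (h : Le m n) : n = m ∨ Le (NF.succ m) n := by
  refine h.induction (k := 0) (P := fun n => n = m ∨ Le (NF.succ m) n)
    (.or (.eq_const _ _) (.const_le _ _)) (Or.inl rfl) ?_
  rintro n (rfl | h)
  · exact Or.inr (Le.refl _)
  · exact Or.inr h.le_succ

theorem IsNat.zero_le {n : M} (hn : IsNat n) : Le (zero M) n := isNat_iff.1 hn

theorem IsNat.le_total {m n : M} (hm : IsNat m) (hn : IsNat n) : Le m n ∨ Le n m := by
  refine hm.induction (k := 0) (P := fun m => Le m n ∨ Le n m)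
    (.or (PDef.inst (R := fun v n => Le (v 0) n) 0 n (.le _ _)) (.const_le _ _))
    (Or.inl hn.zero_le) ?_
  rintro m - (h | h)
  · rcases h.eq_or_succ_le with rfl | h
    · exact Or.inr (Le.refl _).le_succ
    · exact Or.inl h
  · exact Or.inr h.le_succ

/-- Everything above `succ (succ n)` is the successor of something above `succ n`; by injectivity a
counterexample at `succ n` descends to one at `n`. -/
theorem not_succ_le (hne : ∀ n : M, IsNat n → ∃ x, x ∈' n) {n : M} (hn : IsNat n) :
    ¬ Le (succ n) n := by
  refine hn.induction (k := 0) (P := fun n => ¬ Le (succ n) n)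
    (PDef.congr (R := fun v => ¬ ∃ m, m = succ (v 0) ∧ Le m (v 0))
      (.not (.ex 0 (.and (.succ _ _) (.le _ _)))) fun v => by simp) ?_ ?_
  · intro h
    exact h.induction (k := 0) (P := fun n => n ≠ zero M) (.not (.eq_const _ _)) (succ_ne_zero _)
      (fun _ _ => succ_ne_zero _) rfl
  · intro n hn ih h
    apply ih
    obtain ⟨j, hj, hj', hj''⟩ := h.induction (k := 0)
      (P := fun k => ∃ j, IsNat j ∧ k = succ j ∧ Le (succ n) j)
      (.ex 0 (.and (.isNat _) (.and (.succ _ _) (.const_le _ _))))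
      ⟨succ n, hn.isNat_succ, rfl, Le.refl _⟩ (by
        rintro _ ⟨j, hj, rfl, hj'⟩
        exact ⟨succ j, hj.isNat_succ, rfl, hj'.le_succ⟩)
    obtain rfl := succ_inj hne hn hj hj'
    exact hj''

theorem IsNat.le_antisymm (hne : ∀ n : M, IsNat n → ∃ x, x ∈' n) {m n : M} (hm : IsNat m)
    (h : Le m n) (h' : Le n m) : n = m :=
  h.eq_or_succ_le.resolve_right fun h'' => not_succ_le hne hm (h''.trans h')

/-! ### The Axiom of Counting -/

theorem PDef.singletons {n : ℕ} {σ : Fin n → ℕ} (i j : Fin n)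
    (h : σ j = σ i + 1 := by first | rfl | (simp; done) | (simp; omega)) :
    PDef σ (fun v : Fin n → M => v j = singletons (v i)) := by
  refine PDef.rel (a := 1) (b := 2) (R := fun x y => y = NF.singletons x) ?_ i j (by omega)
  refine PDef.congr (R := fun v => ∀ s, s ∈' v 1 ↔ ∃ x, x ∈' v 0 ∧ IsSingleton s x)
    (.all 1 (.iff (.mem _ _) (.ex 0 (.and (.mem _ _) (.singleton _ _))))) fun v => ?_
  constructor
  · exact fun h => Model.extensionality _ _ fun s => (h s).trans mem_singletons.symm
  · intro h
    rw [h]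
    exact fun s => mem_singletons

theorem singletons_mem_succ {m n x : M} (h : ∀ y, y ∈' n → singletons y ∈' m)
    (hx : x ∈' succ n) : singletons x ∈' succ m := by
  obtain ⟨y, a, hy, ha, hw⟩ := mem_succ.1 hx
  obtain ⟨s, hs⟩ := exists_singleton a
  refine mem_succ.2 ⟨singletons y, s, h y hy, fun hs' => ?_, fun w => ?_⟩
  · obtain ⟨a', ha', hs'⟩ := mem_singletons.1 hs'
    rw [hs.inj hs'] at ha
    exact ha ha'
  · rw [mem_singletons, mem_singletons]
    constructor
    · rintro ⟨b, hb, hb'⟩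
      rcases (hw b).1 hb with hb | rfl
      · exact Or.inl ⟨b, hb, hb'⟩
      · exact Or.inr (hb'.unique hs)
    · rintro (⟨b, hb, hb'⟩ | rfl)
      · exact ⟨b, (hw b).2 (Or.inl hb), hb'⟩
      · exact ⟨a, (hw a).2 (Or.inr rfl), hs⟩

/-- The operation `T` on natural numbers: `T n` is the number of singletons of members of a set
with `n` elements. -/
theorem exists_typeRaise (hne : ∀ n : M, IsNat n → ∃ x, x ∈' n) : ∃ t : M → M,
    (∀ n, IsNat n → IsNat (t n)) ∧ t (zero M) = zero M ∧
    (∀ n, IsNat n → t (succ n) = succ (t n)) ∧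
    PDef ![2, 3] (fun v : Fin 2 → M => IsNat (v 0) ∧ v 1 = t (v 0)) := by
  have key : ∀ n : M, ∃ m : M, IsNat n → IsNat m ∧ ∀ x, x ∈' n → singletons x ∈' m := by
    intro n
    by_cases hn : IsNat n
    swap
    · exact ⟨n, fun h => (hn h).elim⟩
    -- Writing `singletons x` as a variable `y` exposes the stratification: `x`, `y`, `n`, `m` have
    -- types `1`, `2`, `2`, `3`.
    suffices ∃ m, IsNat m ∧ ∀ x, x ∈' n → ∀ y, y = singletons x → y ∈' m by
      obtain ⟨m, h1, h2⟩ := this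
      exact ⟨m, fun _ => ⟨h1, fun x hx => h2 x hx _ rfl⟩⟩
    refine hn.induction (k := 2)
      (P := fun n => ∃ m, IsNat m ∧ ∀ x, x ∈' n → ∀ y, y = singletons x → y ∈' m)
      (.ex 3 (.and (.isNat _) (.all 1 (.imp (.mem _ _) (.all 2 (.imp (.singletons _ _)
        (.mem _ _))))))) ?_ ?_
    · refine ⟨zero M, isNat_zero, ?_⟩
      rintro x hx _ rfl
      rw [mem_zero] at hx ⊢
      intro w hw
      obtain ⟨x', hx', -⟩ := mem_singletons.1 hw
      exact hx x' hx'
    · rintro n hn ⟨m, hm, h⟩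
      refine ⟨succ m, hm.isNat_succ, ?_⟩
      rintro x hx _ rfl
      exact singletons_mem_succ (fun y hy => h y hy _ rfl) hx
  choose t ht using key
  have hu : ∀ n m x, IsNat n → IsNat m → x ∈' n → singletons x ∈' m → m = t n :=
    fun n m x hn hm hx hx' => hm.eq_of_mem (ht n hn).1 hx' ((ht n hn).2 x hx)
  refine ⟨t, fun n hn => (ht n hn).1, ?_, fun n hn => ?_, ?_⟩
  · obtain ⟨x, hx⟩ := hne _ (isNat_zero (M := M))
    refine (hu _ _ x isNat_zero isNat_zero hx (mem_zero.2 fun w hw => ?_)).symm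
    obtain ⟨x', hx', -⟩ := mem_singletons.1 hw
    exact mem_zero.1 hx x' hx'
  · obtain ⟨x, hx⟩ := hne _ hn.isNat_succ
    exact (hu _ _ x hn.isNat_succ (ht n hn).1.isNat_succ hx
      (singletons_mem_succ (ht n hn).2 hx)).symm
  · refine PDef.congr (R := fun v => IsNat (v 0) ∧ IsNat (v 1) ∧
      ∃ x y, x ∈' v 0 ∧ y = singletons x ∧ y ∈' v 1)
      (.and (.isNat _) (.and (.isNat _) (.ex 1 (.ex 2 (.and (.mem _ _)
        (.and (.singletons _ _) (.mem _ _))))))) fun v => ?_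
    constructor
    · rintro ⟨h1, h2, x, y, h3, rfl, h4⟩
      exact ⟨h1, hu _ _ x h1 h2 h3 h4⟩
    · rintro ⟨h1, h2⟩
      obtain ⟨x, hx⟩ := hne _ h1
      rw [h2]
      exact ⟨h1, (ht _ h1).1, x, _, hx, rfl, (ht _ h1).2 x hx⟩

/-- The Axiom of Counting makes equality of natural numbers definable between types that differ
by two. -/
theorem AxiomOfCounting.pdef (h : AxiomOfCounting M) :
    PDef ![2, 4] (fun v : Fin 2 → M => IsNat (v 0) ∧ v 1 = v 0) := by
  have hz : PDef ![2] (fun v : Fin 1 → M => IsZero (v 0)) :=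
    PDef.congr (.eq_const 0 (zero M)) fun v => isZero_iff.symm
  -- With `m` and `n` at type `2`, the set `s` of numbers has type `3` and its cardinal type `4`.
  -- Numerals being disjoint, the axiom says that this cardinal is `n`.
  refine PDef.congr (R := fun v => IsNat (v 0) ∧ IsNat (v 1) ∧
    ∃ s, (∀ m, m ∈' s ↔ IsNat m ∧ ¬ IsZero m ∧ NatLE m (v 0)) ∧ s ∈' v 1)
    (.and (.isNat _) (.and (.isNat _) (.ex 3 (.and (.all 2 (.iff (.mem _ _) (.and (.isNat _)
      (.and (.not (hz.rel' _)) (.ex 1 (.ex 1 (.and (.mem _ _) (.and (.mem _ _)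
        (.sub _ _))))))))) (.mem _ _))))) fun v => ?_
  constructor
  · rintro ⟨h1, h2, s, hs, hs'⟩
    obtain ⟨s', h3, h4⟩ := h _ h1
    have : s' = s := Model.extensionality _ _ fun m => (h3 m).trans (hs m).symm
    rw [this] at h4
    exact ⟨h1, h2.eq_of_mem h1 hs' h4⟩
  · rintro ⟨h1, h2⟩
    rw [h2]
    exact ⟨h1, h1, h _ h1⟩

/-- The Axiom of Counting makes the set of natural numbers strongly cantorian. -/
theorem AxiomOfCounting.stronglyCantorian_natSet (h : AxiomOfCounting M) :
    StronglyCantorian (natSet M) := by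
  have hne := h.exists_mem
  obtain ⟨t, ht, ht0, hts, htd⟩ := exists_typeRaise hne
  -- The equation `t (t n) = n` compares types `4` and `2`; `n'` is the copy of `n` at type `4`
  -- supplied by the Axiom of Counting, which makes the induction stratified.
  have htt : ∀ n, IsNat n → t (t n) = n := fun n hn => by
    obtain ⟨m, m', n', ⟨-, rfl⟩, ⟨-, rfl⟩, ⟨-, rfl⟩, h'⟩ := hn.induction (k := 2)
      (P := fun n => ∃ m m' n', (IsNat n ∧ m = t n) ∧ (IsNat m ∧ m' = t m) ∧
        (IsNat n ∧ n' = n) ∧ m' = n')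
      (.ex 3 (.ex 4 (.ex 4 (.and (htd.rel (R := fun n m => IsNat n ∧ m = t n) _ _)
        (.and (htd.rel (R := fun n m => IsNat n ∧ m = t n) _ _)
          (.and (h.pdef.rel (R := fun n m => IsNat n ∧ m = n) _ _) (.eq _ _)))))))
      ⟨_, _, _, ⟨isNat_zero, rfl⟩, ⟨ht _ isNat_zero, rfl⟩, ⟨isNat_zero, rfl⟩, by rw [ht0, ht0]⟩ (by
        rintro n hn ⟨m, m', n', ⟨-, h1⟩, ⟨-, h2⟩, ⟨-, h3⟩, h'⟩
        subst h1 h2 h3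
        exact ⟨_, _, _, ⟨hn.isNat_succ, rfl⟩, ⟨ht _ hn.isNat_succ, rfl⟩, ⟨hn.isNat_succ, rfl⟩,
          by
            rw [hts _ hn, hts _ (ht _ hn), h']⟩)
    exact h'
  have hmono : ∀ m n, IsNat m → Le m n → Le (t m) (t n) := fun m n hm hmn => by
    obtain ⟨-, l, ⟨-, rfl⟩, h⟩ := hmn.induction (k := 2)
      (P := fun n => IsNat n ∧ ∃ l, (IsNat n ∧ l = t n) ∧ Le (t m) l)
      (.and (.isNat _) (.ex 3 (.and (htd.rel (R := fun n m => IsNat n ∧ m = t n) _ _)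
        (.const_le _ _)))) ⟨hm, _, ⟨hm, rfl⟩, Le.refl _⟩ (by
        rintro k ⟨hk, _, ⟨-, rfl⟩, hl⟩
        exact ⟨hk.isNat_succ, _, ⟨hk.isNat_succ, rfl⟩, by rw [hts k hk]; exact hl.le_succ⟩)
    exact h
  -- A monotone involution of a total order is the identity. Direct induction on `t n = n` would be
  -- unstratified at this stage.
  have hteq : ∀ n, IsNat n → t n = n := fun n hn => by
    rcases hn.le_total (ht n hn) with hl | hl
    · have := hmono _ _ hn hl
      rw [htt n hn] at this
      exact hn.le_antisymm hne hl this
    · have := hmono _ _ (ht n hn) hl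
      rw [htt n hn] at this
      exact hn.le_antisymm hne this hl
  refine stronglyCantorian_iff.2 (PDef.rel (a := 3) (b := 2)
    (R := fun m n => m ∈' natSet M ∧ n = m) ?_ _ _)
  refine PDef.congr (htd.rel (R := fun n m => IsNat n ∧ m = t n) 1 0) fun v => ?_
  rw [mem_natSet]
  constructor
  · rintro ⟨h1, h2⟩
    rw [h2, hteq _ h1]
    exact ⟨h1, rfl⟩
  · rintro ⟨h1, h2⟩
    rw [h2, hteq _ h1]
    exact ⟨h1, rfl⟩

/-! ### Recursion -/

theorem exists_recursion (hne : ∀ n : M, IsNat n → ∃ x, x ∈' n) {X : SetCat M} (x₀ : X.Elem)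
    (f : X ⟶ X) : ∃ h : (⟨natSet M⟩ : SetCat M) ⟶ X,
      (∀ n : Elem ⟨natSet M⟩, n.1 = zero M → ev h n = x₀) ∧
      ∀ n m : Elem ⟨natSet M⟩, m.1 = succ n.1 → ev h m = ev f (ev h n) := by
  -- `G` is the least relation containing `(0, x₀)` and closed under `(k, z) ↦ (k + 1, f z)`. Its
  -- arguments share a type because `f` preserves types.
  let G : M → M → Prop := fun n y => ∀ R, PairMem R (zero M) x₀.1 →
    (∀ k z k' z', PairMem R k z → k' = succ k → Rel f z z' → PairMem R k' z') → PairMem R n y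
  have hG : PDef ![0, 0] (fun v => G (v 0) (v 1)) :=
    .all 3 (.imp (.pairMem_const _ _ _) (.imp (.all 0 (.all 0 (.all 0 (.all 0 (.imp (.pairMem _ _ _)
      (.imp (.succ _ _) (.imp (.hom _ _ _) (.pairMem _ _ _)))))))) (.pairMem _ _ _)))
  have hG0 : G (zero M) x₀.1 := fun R h _ => h
  have hGs : ∀ n (y : X.Elem), G n y.1 → G (succ n) (ev f y).1 := fun n y h R h0 hs =>
    hs _ _ _ _ (h R h0 hs) rfl ((rel_iff _ _ _).2 rfl)
  have hGi : ∀ Q : M → M → Prop, PDef ![0, 0] (fun v => Q (v 0) (v 1)) → Q (zero M) x₀.1 →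
      (∀ k (z : X.Elem), Q k z.1 → Q (succ k) (ev f z).1) → ∀ n y, G n y → Q n y := by
    intro Q hQ h0 hs n y h
    obtain ⟨R, hR⟩ := PDef.comprehension (k := 2) (R := fun p => ∃ n y, Q n y ∧ IsPair p n y)
      (.ex 0 (.ex 0 (.and (hQ.rel _ _) (.pair _ _ _))))
    have hR' : ∀ n y, PairMem R n y ↔ Q n y := by
      intro n y
      constructor
      · rintro ⟨p, hp, hp'⟩
        obtain ⟨n', y', h, h'⟩ := (hR p).1 hp
        obtain ⟨rfl, rfl⟩ := hp'.inj h'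
        exact h
      · intro h
        obtain ⟨p, hp⟩ := exists_pair n y
        exact ⟨p, (hR p).2 ⟨n, y, h, hp⟩, hp⟩
    refine (hR' n y).1 (h R ((hR' _ _).2 h0) ?_)
    rintro k z _ z' hk rfl hz
    obtain ⟨z, rfl, rfl⟩ := (rel_iff' _).1 hz
    exact (hR' _ _).2 (hs _ _ ((hR' _ _).1 hk))
  have hGu : ∀ n, IsNat n → ∃ y, y ∈' X.carrier ∧ G n y ∧ ∀ y', G n y' → y' = y := by
    intro n hn
    refine hn.induction (k := 0)
      (P := fun n => ∃ y, y ∈' X.carrier ∧ G n y ∧ ∀ y', G n y' → y' = y)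
      (.ex 0 (.and (.mem_const _ _) (.and (hG.rel _ _) (.all 0 (.imp (hG.rel _ _) (.eq _ _))))))
      ⟨x₀.1, x₀.2, hG0, fun y' hy' => ?_⟩ ?_
    · exact hGi (fun n y => n = zero M → y = x₀.1) (.imp (.eq_const _ _) (.eq_const _ _))
        (fun _ => rfl) (fun k _ _ h => (succ_ne_zero k h).elim) _ _ hy' rfl
    · rintro n hn ⟨y, hy, hy', hu⟩
      refine ⟨(ev f ⟨y, hy⟩).1, (ev f _).2, hGs n ⟨y, hy⟩ hy', fun y' h => ?_⟩
      -- Single-valuedness at `succ n` needs `G k z` inside the invariant: when `succ k = succ n`,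
      -- injectivity gives `k = n`, and then the induction hypothesis determines `z`.
      refine (hGi (fun k z => G k z ∧ IsNat k ∧ (k = succ n → z = (ev f ⟨y, hy⟩).1))
        (.and (hG.rel _ _) (.and (.isNat _) (.imp (.eq_const _ _) (.eq_const _ _))))
        ⟨hG0, isNat_zero, fun h => (succ_ne_zero n h.symm).elim⟩ ?_ _ _ h).2.2 rfl
      rintro k z ⟨h1, h2, -⟩
      refine ⟨hGs k z h1, h2.isNat_succ, fun h => ?_⟩
      obtain rfl := succ_inj hne h2 hn h
      rw [show z = ⟨y, hy⟩ from Subtype.ext (hu _ h1)]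
  obtain ⟨h, hh⟩ := exists_hom (A := ⟨natSet M⟩) (B := X) (a := 0) G hG fun n => by
    obtain ⟨y, hy, hy', hu⟩ := hGu n.1 (mem_natSet.1 n.2)
    exact ⟨⟨y, hy⟩, hy', fun y' h => Subtype.ext (hu _ h)⟩
  have hu : ∀ n : Elem ⟨natSet M⟩, ∀ y : X.Elem, G n.1 y.1 → ev h n = y := by
    intro n y hy
    obtain ⟨z, -, -, hz⟩ := hGu n.1 (mem_natSet.1 n.2)
    exact Subtype.ext ((hz _ (hh n)).trans (hz _ hy).symm)
  refine ⟨h, fun n hn => hu n x₀ (hn ▸ hG0), fun n m hm => hu m _ ?_⟩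
  rw [hm]
  exact hGs _ _ (hh n)

/-- A morphism from the natural numbers is determined by its recursion equations. -/
theorem eq_of_recursion {X : SetCat M} {f : X ⟶ X} {h h' : (⟨natSet M⟩ : SetCat M) ⟶ X}
    (h0 : ∀ n : Elem ⟨natSet M⟩, n.1 = zero M → ev h n = ev h' n)
    (hs : ∀ n m : Elem ⟨natSet M⟩, m.1 = succ n.1 → ev h m = ev f (ev h n))
    (hs' : ∀ n m : Elem ⟨natSet M⟩, m.1 = succ n.1 → ev h' m = ev f (ev h' n)) : h = h' := by
  refine SetCat.hom_ext fun n => ?_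
  obtain ⟨y, h1, h2⟩ := (mem_natSet.1 n.2).induction (k := 0)
    (P := fun n => ∃ y, Rel h n y ∧ Rel h' n y) (.ex 0 (.and (.hom _ _ _) (.hom _ _ _)))
    ⟨_, (rel_iff h ⟨_, mem_natSet.2 isNat_zero⟩ _).2 rfl,
      (rel_iff h' ⟨_, mem_natSet.2 isNat_zero⟩ _).2
        (congrArg Subtype.val (h0 ⟨_, mem_natSet.2 isNat_zero⟩ rfl))⟩ (by
    rintro k hk ⟨y, h1, h2⟩
    obtain ⟨k, rfl⟩ : ∃ k' : Elem ⟨natSet M⟩, k'.1 = k := ⟨⟨k, mem_natSet.2 hk⟩, rfl⟩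
    obtain ⟨m, hm⟩ : ∃ m : Elem ⟨natSet M⟩, m.1 = succ k.1 :=
      ⟨⟨_, mem_natSet.2 hk.isNat_succ⟩, rfl⟩
    rw [rel_iff] at h1 h2
    rw [← hm]
    refine ⟨_, (rel_iff h m _).2 rfl, (rel_iff h' m _).2 ?_⟩
    rw [hs k m hm, hs' k m hm, show ev h k = ev h' k from Subtype.ext (h1.symm.trans h2)])
  rw [rel_iff] at h1 h2
  exact Subtype.ext (h1.symm.trans h2)

theorem exists_succ_hom : ∃ s : (⟨natSet M⟩ : SetCat M) ⟶ ⟨natSet M⟩,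
    ∀ n, (ev s n).1 = succ n.1 :=
  exists_hom (A := ⟨natSet M⟩) (B := ⟨natSet M⟩) (a := 0) (fun n m => m = succ n) (.succ _ _)
    fun n => ⟨⟨succ n.1, mem_natSet.2 (mem_natSet.1 n.2).isNat_succ⟩, rfl,
      fun _ h => Subtype.ext h⟩

theorem AxiomOfCounting.hasNNO (h : AxiomOfCounting M) : HasNNO (SC M) := by
  obtain ⟨T, ⟨hT⟩⟩ := (subsetClosed_sc (M := M)).point
  obtain ⟨hT'⟩ := subsetClosed_sc.nonempty_isTerminal ⟨hT⟩
  let N : SetCat M := ⟨natSet M⟩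
  obtain ⟨n₀, hn₀⟩ : ∃ n₀ : N.Elem, n₀.1 = zero M := ⟨⟨_, mem_natSet.2 isNat_zero⟩, rfl⟩
  obtain ⟨z, hz⟩ := exists_const T.obj n₀
  obtain ⟨s, hs⟩ : ∃ s : N ⟶ N, ∀ n, (ev s n).1 = succ n.1 := exists_succ_hom
  refine ⟨T, ⟨N, h.stronglyCantorian_natSet⟩, hT', ObjectProperty.homMk z, ObjectProperty.homMk s,
    fun X x f => ?_⟩
  have t₀ : T.obj.Elem := hT.default
  have ht : ∀ t : T.obj.Elem, t = t₀ := fun t => (hT.uniq t).trans (hT.uniq t₀).symm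
  obtain ⟨r, hr0, hrs⟩ : ∃ r : N ⟶ X.obj, (∀ n, n.1 = zero M → ev r n = ev x.hom t₀) ∧
    ∀ n m, m.1 = succ n.1 → ev r m = ev f.hom (ev r n) :=
    exists_recursion h.exists_mem (ev x.hom t₀) f.hom
  refine ⟨ObjectProperty.homMk r, ⟨?_, ?_⟩, ?_⟩
  · refine ObjectProperty.hom_ext _ (SetCat.hom_ext fun t => ?_)
    change ev r (ev z t) = ev x.hom t
    rw [hz, hr0 _ hn₀, ht t]
  · refine ObjectProperty.hom_ext _ (SetCat.hom_ext fun n => ?_)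
    exact hrs _ _ (hs n)
  · rintro r' ⟨h1, h2⟩
    refine ObjectProperty.hom_ext _ (eq_of_recursion (f := f.hom) (fun n hn => ?_)
      (fun n m hm => ?_) hrs)
    · have h3 : ev r'.hom (ev z t₀) = ev x.hom t₀ := congrArg (fun k => ev k.hom t₀) h1
      rw [hz] at h3
      obtain rfl : n = n₀ := Subtype.ext (hn.trans hn₀.symm)
      exact h3.trans (hr0 _ hn₀).symm
    · have h3 : ev r'.hom (ev s n) = ev f.hom (ev r'.hom n) := congrArg (fun k => ev k.hom n) h2
      rwa [show ev s n = m from Subtype.ext ((hs n).trans hm.symm)] at h3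

end Naturals
end NF

theorem mainTheorem4 {M : Type u} [NF.setLang.Structure M] [NF.Model M] :
    -- closure under subsets
    (∀ A B : M, NF.StronglyCantorian A → NF.Sub B A → NF.StronglyCantorian B) ∧
    -- closure under power sets
    (∀ A : M, NF.StronglyCantorian A → NF.StronglyCantorian (NF.power A)) ∧
    -- closure under finite products: the set of ordered pairs, and every set that is
    -- a product in the category of all sets (which exists), empty and binary
    (∀ A B : M, NF.StronglyCantorian A → NF.StronglyCantorian B →
      NF.StronglyCantorian (NF.cartesian A B)) ∧
    (HasTerminal (NF.SetCat M) ∧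
      ∀ X : NF.SetCat M, IsTerminal X → NF.StronglyCantorian X.carrier) ∧
    (∀ A B : NF.SetCat M, NF.StronglyCantorian A.carrier → NF.StronglyCantorian B.carrier →
      HasBinaryProduct A B ∧
      ∀ c : BinaryFan A B, IsLimit c → NF.StronglyCantorian c.pt.carrier) ∧
    -- the full subcategory is a topos
    NF.IsElementaryTopos (NF.SC M) ∧
    -- for all sets `A`, `B` and every product `TA × B`, morphisms `B ⟶ P A` correspond to
    -- subobjects of `TA × B`, through the membership relation
    (∀ (A B : NF.SetCat M) (c : BinaryFan A.T B), IsLimit c →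
      ∃ e : (B ⟶ A.P) ≃ Subobject c.pt,
        ∀ (f : B ⟶ A.P) (X : NF.SetCat M) (h : X ⟶ c.pt),
          (e f).Factors h ↔ ∀ (x : X.Elem) (a : M),
            NF.IsSingleton (NF.SetCat.app (h ≫ c.fst) x) a →
              NF.Mem a (NF.SetCat.app (h ≫ c.snd ≫ f) x)) ∧
    -- for strongly cantorian `A`, the power set of `A` represents `Sub(TA × -)` and
    -- `Sub(A × -)` on the strongly cantorian sets, through the membership relation
    (∃ _ : HasFiniteLimits (NF.SC M), ∀ A : NF.SC M,
      ∃ (hT : NF.stronglyCantorian M A.obj.T) (hP : NF.stronglyCantorian M A.obj.P),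
        (∃ e : (NF.subProd (⟨A.obj.T, hT⟩ : NF.SC M)).RepresentableBy ⟨A.obj.P, hP⟩,
          ∀ (B : NF.SC M) (f : B ⟶ ⟨A.obj.P, hP⟩) (X : NF.SC M)
            (h : X ⟶ (⟨A.obj.T, hT⟩ : NF.SC M) ⨯ B),
            Subobject.Factors (e.homEquiv f : Subobject ((⟨A.obj.T, hT⟩ : NF.SC M) ⨯ B)) h ↔
              ∀ (x : X.obj.Elem) (a : M),
                NF.IsSingleton (NF.SetCat.app (h ≫ prod.fst).hom x) a →
                  NF.Mem a (NF.SetCat.app (h ≫ prod.snd ≫ f).hom x)) ∧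
        (∃ e : (NF.subProd A).RepresentableBy ⟨A.obj.P, hP⟩,
          ∀ (B : NF.SC M) (f : B ⟶ ⟨A.obj.P, hP⟩) (X : NF.SC M) (h : X ⟶ A ⨯ B),
            Subobject.Factors (e.homEquiv f : Subobject (A ⨯ B)) h ↔
              ∀ x : X.obj.Elem,
                NF.Mem (NF.SetCat.app (h ≫ prod.fst).hom x)
                  (NF.SetCat.app (h ≫ prod.snd ≫ f).hom x))) ∧
    -- the Axiom of Counting yields a natural numbers object
    (NF.AxiomOfCounting M → NF.HasNNO (NF.SC M)) := by
  refine ⟨fun A B hA h => hA.subset h, fun A hA => hA.power, fun A B hA hB => hA.cartesian hB,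
    ⟨NF.subsetClosed_id.hasTerminal, fun X hX => NF.stronglyCantorian_of_isTerminal hX⟩,
    fun A B hA hB => ⟨NF.hasBinaryProduct_of_sc hA hB,
      fun c hc => NF.stronglyCantorian_of_isLimit hA hB c hc⟩,
    NF.SC.isElementaryTopos, fun A B c hc => ?_, ⟨inferInstance, fun A => ?_⟩,
    fun h => h.hasNNO⟩
  · obtain ⟨e, he⟩ := NF.subsetClosed_id.exists_equiv_subobject (X := A.T) (B := B)
      (NF.subsetClosed_id.existsUnique_of_isLimit hc) (P := A.P) (A := A.carrier)
      (fun _ => NF.mem_power)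
      (E := fun t a => NF.IsSingleton t a ∧ NF.Mem a A.carrier) (NF.PDef.singleton_and_mem _)
      (fun _ _ h => h.2)
      (NF.existsUnique_isSingleton (A := A)) NF.existsUnique_isSingleton'
    exact ⟨e, fun f X h => (he f X h).trans (forall_congr' fun x => forall_congr' fun a =>
      imp_congr_left (NF.isSingleton_and_mem_iff _))⟩
  · refine ⟨A.property.singletons, A.property.power, ?_, ?_⟩
    · obtain ⟨e, he⟩ := NF.SC.exists_representableBy_of_rel
        (A := ⟨A.obj.T, A.property.singletons⟩) (P := ⟨A.obj.P, A.property.power⟩)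
        (S := A.obj.carrier) (fun _ => NF.mem_power)
        (E := fun t a => NF.IsSingleton t a ∧ NF.Mem a A.obj.carrier) (NF.PDef.singleton_and_mem _)
        (fun _ _ h => h.2)
        (NF.existsUnique_isSingleton (A := A.obj)) NF.existsUnique_isSingleton'
      exact ⟨e, fun B f X h => (he B f X h).trans (forall_congr' fun x => forall_congr' fun a =>
        imp_congr_left (NF.isSingleton_and_mem_iff _))⟩
    · obtain ⟨e, he⟩ := NF.SC.exists_representableBy_of_mem A
        (P := ⟨A.obj.P, A.property.power⟩) (fun _ => NF.mem_power)
      exact ⟨e, he⟩
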